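/- Let $K$ be a non-archimedean local field of characteristic $p>0$ with ring of integers $\mathcal{O}_K$, unit group $\mathcal{O}_K^\times$, a fixed uniformizer $\pi$, and residue field with $q$ elements. For $x\in K^\times$ write $x=ac(x)\,\pi^{\mathrm{ord}(x)}$ with $ac(x)\in\mathcal{O}_K^\times$, and put $|x|=q^{-\mathrm{ord}(x)}$, $|0|=0$. Let $|dx\,dy|$ be the Haar measure on $K^2$ normalized so that $\mathcal{O}_K^2$ has measure $1$. Let $\chi:\mathcal{O}_K^\times\to\mathbb{C}^\times$ be a continuous multiplicative character, with the convention $\chi(ac(0))=0$. For a polynomial $g\in\mathcal{O}_K[x,y]$ and $s\in\mathbb{C}$ with $\mathrm{Re}(s)>0$ let $$Z_g(s,\chi)=\int_{\mathcal{O}_K^2}\chi(ac\,g(x,y))\,|g(x,y)|^s\,|dx\,dy|.$$ **Theorem 1.2.** Let $m\ge 2$ be an integer with $p\nmid m$, and let $f\in\mathcal{O}_K[x]$ be a nonzero polynomial that splits completely over $K$: $f(x)=\gamma_0\prod_{i=1}^k(x-\gamma_i)^{n_i}$ with $\gamma_0\in K^\times$, pairwise distinct $\gamma_1,\dots,\gamma_k\in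 K$, and integers $n_i\ge 1$. Let $g(x,y)=y^m-f(x)$. Put $T=\{i : 1\le i\le k,\ \gamma_i\in\mathcal{O}_K\}$, $\tilde n_i=n_i/\gcd(n_i,m)$ and $m_i=m/\gcd(n_i,m)$. Then $Z_g(s,\chi)$ is a rational function of $q^{-s}$. More explicitly, there is a polynomial $G\in\mathbb{C}[x]$ (not depending on $s$) such that for all $s$ with $\mathrm{Re}(s)>0$ the integral $Z_g(s,\chi)$ converges absolutely and $$Z_g(s,\chi)=\frac{G(q^{-s})}{(1-q^{-1-s})\prod_{i\in T,\ n_i\ge 2}\bigl(1-q^{-\tilde n_i-m_i-\tilde n_i m_i\gcd(n_i,m)s}\bigr)}.$$ In particular the right-hand side continues $Z_g(s,\chi)$ to a meromorphic function on $\mathbb{C}$, and each of its poles is of the form $$s=-1+\frac{2\pi\sqrt{-1}\,l}{\log q}\qquad\text{or}\qquad s=\frac{1}{\tilde n_i m_i\gcd(n_i,m)}\Bigl(-(\tilde n_i+m_i)+\frac{2\pi\sqrt{-1}\,l}{\log q}\Bigr)$$ for some $l\in\mathbb{Z}$ and, in the second case, some $i\in T$ with $n_i\ge 2$. -/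

import Mathlib

open MeasureTheory Polynomial ValuativeRel

namespace LocalZeta

noncomputable section

variable {K : Type*} [Field K] [ValuativeRel K] [TopologicalSpace K]
  [IsNonarchimedeanLocalField K]

/-- The normalized valuation `ord : K → ℤ` of a non-archimedean local field, normalized to be onto
`ℤ` on the nonzero elements. The value at `0` is the junk value `0`; it is never used. -/
def ord (x : K) : ℤ :=
  -WithZero.log (IsNonarchimedeanLocalField.valueGroupWithZeroIsoInt K (valuation K x))

variable (K) in
/-- The cardinality `q` of the residue field. -/
def residueCard : ℕ := Nat.card 𝓀[K]

open Classical in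
/-- The normalized absolute value `|x| = q ^ (-ord x)`, with `|0| = 0`. -/
def absVal (x : K) : ℝ := if x = 0 then 0 else (residueCard K : ℝ) ^ (-ord x)

open Classical in
/-- `χ (ac x)` for a character `χ` of the unit group and a uniformizer `ϖ`: the angular component
`ac x` of `x ≠ 0` is the unit `u` with `x = u * ϖ ^ ord x` (it exists and is unique, see
`existsUnique_angular`). At `x = 0` there is no such unit and the value is `0`. -/
def charAC (ϖ : 𝒪[K]) (χ : (𝒪[K])ˣ →* ℂˣ) (x : K) : ℂ :=
  if h : ∃ u : (𝒪[K])ˣ, x = ((u : 𝒪[K]) : K) * (ϖ : K) ^ ord x then (χ h.choose : ℂ) else 0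

/-- The integrand `χ (ac (g z)) |g z| ^ s` of the local zeta function, for `g : K² → K`. -/
def zetaIntegrand (ϖ : 𝒪[K]) (χ : (𝒪[K])ˣ →* ℂˣ) (g : K × K → K) (s : ℂ) (z : K × K) : ℂ :=
  charAC ϖ χ (g z) * (absVal (g z) : ℂ) ^ s

variable (K) in
/-- The square `𝒪 × 𝒪` of the ring of integers, as a subset of `K²`. -/
def integerSquare : Set (K × K) := (𝒪[K] : Set K) ×ˢ (𝒪[K] : Set K)

/-- Igusa's local zeta function `∫_{𝒪²} χ (ac (g z)) |g z| ^ s |dz|` in two variables. Here `μ` is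
to be the Haar measure on `K` with `μ 𝒪 = 1`, so `μ.prod μ` is the one on `K²`. -/
def igusaZeta [MeasurableSpace K] (μ : Measure K) (ϖ : 𝒪[K]) (χ : (𝒪[K])ˣ →* ℂˣ)
    (g : K × K → K) (s : ℂ) : ℂ :=
  ∫ z in integerSquare K, zetaIntegrand ϖ χ g s z ∂(μ.prod μ)

lemma ord_mul {x y : K} (hx : x ≠ 0) (hy : y ≠ 0) : ord (x * y) = ord x + ord y := by
  unfold ord
  rw [map_mul, map_mul, WithZero.log_mul (by simpa using hx) (by simpa using hy)]
  ring

lemma ord_nonneg_iff {x : K} (hx : x ≠ 0) : 0 ≤ ord x ↔ x ∈ 𝒪[K] := by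
  unfold ord
  rw [Left.nonneg_neg_iff, ← WithZero.log_one, WithZero.log_le_log (by simpa using hx) (by simp),
    Valuation.mem_integer_iff]
  conv_lhs => rw [← map_one (IsNonarchimedeanLocalField.valueGroupWithZeroIsoInt K)]
  exact map_le_map_iff (IsNonarchimedeanLocalField.valueGroupWithZeroIsoInt K)

lemma ord_inv (x : K) : ord x⁻¹ = -ord x := by
  unfold ord
  simp

lemma ord_unit (u : (𝒪[K])ˣ) : ord ((u : 𝒪[K]) : K) = 0 := by
  have h1 : ((u : 𝒪[K]) : K) * ((↑u⁻¹ : 𝒪[K]) : K) = 1 := by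
    exact_mod_cast congrArg Subtype.val (u.mul_inv)
  have hu : ((u : 𝒪[K]) : K) ≠ 0 := left_ne_zero_of_mul_eq_one h1
  have hv : ((↑u⁻¹ : 𝒪[K]) : K) ≠ 0 := right_ne_zero_of_mul_eq_one h1
  have h2 := ord_mul hu hv
  have h3 : ord (1 : K) = 0 := by simp [ord]
  rw [h1, h3] at h2
  have h4 := (ord_nonneg_iff hu).2 (u : 𝒪[K]).2
  have h5 := (ord_nonneg_iff hv).2 (↑u⁻¹ : 𝒪[K]).2
  omega

/-- A nonzero element of order `0` is a unit of the ring of integers. -/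
lemma exists_unit_of_ord_eq_zero {x : K} (hx : x ≠ 0) (h : ord x = 0) :
    ∃ u : (𝒪[K])ˣ, ((u : 𝒪[K]) : K) = x := by
  have h1 : x ∈ 𝒪[K] := (ord_nonneg_iff hx).1 h.ge
  have h2 : x⁻¹ ∈ 𝒪[K] := (ord_nonneg_iff (inv_ne_zero hx)).1 (by rw [ord_inv x, h]; simp)
  exact ⟨⟨⟨x, h1⟩, ⟨x⁻¹, h2⟩, Subtype.ext (mul_inv_cancel₀ hx), Subtype.ext (inv_mul_cancel₀ hx)⟩,
    rfl⟩

/-- The valuation is normalized: uniformizers have order `1`. -/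
lemma ord_uniformizer {ϖ : 𝒪[K]} (hϖ : Irreducible ϖ) : ord (ϖ : K) = 1 := by
  have h0 : (ϖ : K) ≠ 0 := fun h => hϖ.ne_zero (Subtype.ext h)
  have hpos : 0 ≤ ord (ϖ : K) := (ord_nonneg_iff h0).2 ϖ.2
  have hne : ord (ϖ : K) ≠ 0 := fun h => by
    obtain ⟨u, hu⟩ := exists_unit_of_ord_eq_zero h0 h
    exact hϖ.not_isUnit ⟨u, Subtype.ext hu⟩
  obtain ⟨y, hy⟩ := ValuativeRel.valuation_surjective
    ((IsNonarchimedeanLocalField.valueGroupWithZeroIsoInt K).symm (WithZero.exp (-1 : ℤ)))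
  have hy1 : ord y = 1 := by
    unfold ord
    rw [hy]
    simp
  have hy0 : y ≠ 0 := by
    rintro rfl
    simp [ord] at hy1
  have hyO : y ∈ 𝒪[K] := (ord_nonneg_iff hy0).1 (by omega)
  have hdvd : ϖ ∣ (⟨y, hyO⟩ : 𝒪[K]) := by
    have hnu : ¬ IsUnit (⟨y, hyO⟩ : 𝒪[K]) := by
      rintro ⟨u, hu⟩
      have h1 := ord_unit u
      rw [hu] at h1
      simp only at h1
      omega
    have hmem : (⟨y, hyO⟩ : 𝒪[K]) ∈ IsLocalRing.maximalIdeal 𝒪[K] := hnu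
    rw [hϖ.maximalIdeal_eq] at hmem
    exact Ideal.mem_span_singleton.1 hmem
  obtain ⟨c, hc⟩ := hdvd
  have hc' : y = (ϖ : K) * (c : K) := congrArg Subtype.val hc
  have hc0 : (c : K) ≠ 0 := by
    intro h
    rw [h, mul_zero] at hc'
    exact hy0 hc'
  have h2 := ord_mul h0 hc0
  rw [← hc', hy1] at h2
  have h3 := (ord_nonneg_iff hc0).2 c.2
  omega

/-- Every nonzero element has exactly one angular component. -/
lemma existsUnique_angular {ϖ : 𝒪[K]} (hϖ : Irreducible ϖ) {x : K} (hx : x ≠ 0) :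
    ∃! u : (𝒪[K])ˣ, x = ((u : 𝒪[K]) : K) * (ϖ : K) ^ ord x := by
  have h0 : (ϖ : K) ≠ 0 := fun h => hϖ.ne_zero (Subtype.ext h)
  have hz : ∀ k : ℤ, ord ((ϖ : K) ^ k) = k := by
    intro k
    have h1 := ord_uniformizer hϖ
    unfold ord at h1 ⊢
    rw [map_zpow₀, map_zpow₀, WithZero.log_zpow, smul_eq_mul, ← mul_neg, h1, mul_one]
  have hk : (ϖ : K) ^ ord x ≠ 0 := zpow_ne_zero _ h0
  have hord : ord (x * ((ϖ : K) ^ ord x)⁻¹) = 0 := by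
    rw [ord_mul hx (inv_ne_zero hk), ord_inv _, hz]
    ring
  obtain ⟨u, hu⟩ := exists_unit_of_ord_eq_zero (mul_ne_zero hx (inv_ne_zero hk)) hord
  refine ⟨u, ?_, ?_⟩
  · simp only [hu]
    rw [inv_mul_cancel_right₀ hk]
  · intro v hv
    apply Units.ext
    apply Subtype.ext
    rw [hu, eq_mul_inv_iff_mul_eq₀ hk]
    exact hv.symm

lemma charAC_zero (ϖ : 𝒪[K]) (hϖ : Irreducible ϖ) (χ : (𝒪[K])ˣ →* ℂˣ) :
    charAC ϖ χ (0 : K) = 0 := by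
  have h0 : (ϖ : K) ≠ 0 := fun h => hϖ.ne_zero (Subtype.ext h)
  unfold charAC
  rw [dif_neg]
  rintro ⟨u, hu⟩
  rcases mul_eq_zero.1 hu.symm with h | h
  · exact u.ne_zero (Subtype.ext h)
  · exact zpow_ne_zero _ h0 h

/-- The factor `1 - q ^ (-n/d - m/d - (n/d) (m/d) d s)` with `d = gcd n m` that a root of
multiplicity `n` contributes to the denominator. The divisions by the gcd are exact. -/
def rootFactor (q m n : ℕ) (s : ℂ) : ℂ :=
  1 - (q : ℂ) ^ (-((n / n.gcd m : ℕ) : ℂ) - ((m / n.gcd m : ℕ) : ℂ)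
    - ((n / n.gcd m : ℕ) : ℂ) * ((m / n.gcd m : ℕ) : ℂ) * ((n.gcd m : ℕ) : ℂ) * s)

end

end LocalZeta

set_option linter.unusedSectionVars false

namespace LocalZeta

/-! ### Discs as a neighbourhood basis, and the topology of `K` -/

section Discs

open Filter Topology

variable {K : Type*} [Field K] [ValuativeRel K] [TopologicalSpace K]
  [IsNonarchimedeanLocalField K]

/-! Write `t = q ^ (-s)`, so that the integrand becomes a quasi-character `quasiChar` of `g` and
Fubini gives `Z = ∫ J (f x) dx`, where `J c = ∫ quasiChar (y ^ m - c) dy` is `fiberZeta`. Everything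
rests on three properties of `J`, valid because `m` is a unit.

Let `χ` be trivial on `1 + ϖ ^ N 𝒪`. By Hensel, elements of that group are `m`-th powers in it, so
rescaling `y` shows that `J` is invariant under multiplying `c` by it
(`fiberZeta_mul_of_mem_disc_one`); hence `J` is locally constant off `0`, uniformly in `t`. For `c ≠
0` the roots of `y ^ m - c` are simple, so the denominator of `J c` is only `1 - q⁻¹ t`
(`fiberZeta_mem_polynomialOver`). Splitting off `y ∈ ϖ 𝒪` gives `J (ϖ ^ m c) = A + q⁻¹ t ^ m J c`
for `c ∈ ϖ ^ N 𝒪` (`exists_fiberZeta_pow_mul`).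

Away from the roots of `f`, the outer integral is therefore a finite combination of values of `J`.
Near a root of multiplicity `n` it reduces to `I = ∫ J (β z ^ n) dz`. With `d = gcd n m`, `a = m /
d`, `b = n / d`, one has `a n = m b`, so `z ↦ ϖ ^ a z` and `b` uses of the recursion yield `I = ψ +
q ^ (-a-b) t ^ (m b) I`, which is the stated factor (`setIntegral_fiberZeta_pow_mem`). If `n = 1`,
integrating over `z` first meets a function affine in `z`, and no new factor appears
(`setIntegral_fiberZeta_mul_mem`). -/

/-- The disc `a + c 𝒪`. -/
def disc (a c : K) : Set K := (fun z => a + c * z) '' (𝒪[K] : Set K)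

lemma mem_disc {a c x : K} (hc : c ≠ 0) : x ∈ disc a c ↔ (x - a) / c ∈ 𝒪[K] := by
  constructor
  · rintro ⟨z, hz, rfl⟩
    simpa [hc] using hz
  · intro h
    exact ⟨_, h, by field_simp; ring⟩

lemma disc_zero_one : disc (0 : K) 1 = (𝒪[K] : Set K) := by
  ext x; simp [mem_disc]

instance t2Space : T2Space K := by
  refine IsTopologicalAddGroup.t2Space_of_zero_sep fun x hx => ?_
  refine ⟨{y | valuation K y < valuation K x}, ?_, by simp⟩
  exact (IsValuativeTopology.hasBasis_nhds_zero' K).mem_of_mem (by simpa using hx)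

lemma isCompact_integers : IsCompact (𝒪[K] : Set K) :=
  isCompact_iff_compactSpace.2 (inferInstanceAs (CompactSpace 𝒪[K]))

lemma isCompact_disc (a c : K) : IsCompact (disc a c) :=
  isCompact_integers.image (by fun_prop)

lemma isOpen_integers : IsOpen (𝒪[K] : Set K) :=
  Valuation.isOpen_integer (v := valuation K)

lemma isOpen_disc (a : K) {c : K} (hc : c ≠ 0) : IsOpen (disc a c) := by
  have : disc a c = (fun x => (x - a) / c) ⁻¹' (𝒪[K] : Set K) := by
    ext x; exact mem_disc hc
  rw [this]
  exact isOpen_integers.preimage (by fun_prop)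

lemma self_mem_disc (a c : K) : a ∈ disc a c := ⟨0, zero_mem 𝒪[K], by simp⟩

variable {ϖ : 𝒪[K]}

lemma uniformizer_ne_zero (hϖ : Irreducible ϖ) : (ϖ : K) ≠ 0 :=
  fun h => hϖ.ne_zero (Subtype.ext h)

lemma ord_zpow (x : K) (k : ℤ) : ord (x ^ k) = k * ord x := by
  unfold ord
  rw [map_zpow₀, map_zpow₀, WithZero.log_zpow, smul_eq_mul, ← mul_neg]

lemma ord_pow (x : K) (k : ℕ) : ord (x ^ k) = k * ord x := by
  simpa using ord_zpow x k

lemma ord_one : ord (1 : K) = 0 := by simp [ord]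

lemma ord_div {x y : K} (hx : x ≠ 0) (hy : y ≠ 0) : ord (x / y) = ord x - ord y := by
  rw [div_eq_mul_inv, ord_mul hx (inv_ne_zero hy), ord_inv y]; ring

lemma ord_uniformizer_pow (hϖ : Irreducible ϖ) (e : ℕ) : ord ((ϖ : K) ^ e) = e := by
  rw [ord_pow, ord_uniformizer hϖ, mul_one]

lemma mem_disc_zero_iff_ord (hϖ : Irreducible ϖ) {x : K} (hx : x ≠ 0) (e : ℕ) :
    x ∈ disc 0 ((ϖ : K) ^ e) ↔ (e : ℤ) ≤ ord x := by
  have h0 := pow_ne_zero e (uniformizer_ne_zero hϖ)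
  rw [mem_disc h0, sub_zero, ← ord_nonneg_iff (div_ne_zero hx h0), ord_div hx h0,
    ord_uniformizer_pow hϖ, sub_nonneg]

lemma disc_anti (a : K) (ϖ : 𝒪[K]) {e e' : ℕ} (h : e ≤ e') :
    disc a ((ϖ : K) ^ e') ⊆ disc a ((ϖ : K) ^ e) := by
  rintro _ ⟨z, hz, rfl⟩
  refine ⟨(ϖ : K) ^ (e' - e) * z, mul_mem (pow_mem ϖ.2 _) hz, ?_⟩
  simp only [← mul_assoc, ← pow_add, Nat.add_sub_cancel' h]

lemma disc_subset_integers {a c : K} (ha : a ∈ 𝒪[K]) (hc : c ∈ 𝒪[K]) :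
    disc a c ⊆ (𝒪[K] : Set K) := by
  rintro _ ⟨z, hz, rfl⟩
  exact add_mem ha (mul_mem hc hz)

lemma exists_disc_subset_zero (hϖ : Irreducible ϖ) {s : Set K} (hs : s ∈ 𝓝 (0 : K)) :
    ∃ e : ℕ, disc 0 ((ϖ : K) ^ e) ⊆ s := by
  obtain ⟨γ, hγ, h⟩ := (IsValuativeTopology.hasBasis_nhds_zero' K).mem_iff.1 hs
  obtain ⟨r, rfl⟩ := ValuativeRel.valuation_surjective γ
  have hr : r ≠ 0 := by simpa using hγ
  refine ⟨(ord r).toNat + 1, fun x hx => h ?_⟩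
  rcases eq_or_ne x 0 with rfl | hx0
  · simpa [zero_lt_iff] using hr
  have h1 := (mem_disc_zero_iff_ord hϖ hx0 _).1 hx
  change valuation K x < valuation K r
  rw [← map_lt_map_iff (IsNonarchimedeanLocalField.valueGroupWithZeroIsoInt K),
    ← WithZero.log_lt_log (by simpa using hx0) (by simpa using hr)]
  push_cast at h1
  have := Int.self_le_toNat (-WithZero.log
    (IsNonarchimedeanLocalField.valueGroupWithZeroIsoInt K (valuation K r)))
  unfold ord at h1
  omega

lemma disc_eq_image (a c : K) : disc a c = (fun z => a + z) '' disc 0 c := by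
  simp only [disc, Set.image_image, zero_add]

lemma exists_disc_subset (hϖ : Irreducible ϖ) {x : K} {s : Set K} (hs : s ∈ 𝓝 x) :
    ∃ e₀ : ℕ, ∀ e ≥ e₀, disc x ((ϖ : K) ^ e) ⊆ s := by
  have h : (fun z => x + z) ⁻¹' s ∈ 𝓝 (0 : K) := by
    apply (show Continuous fun z : K => x + z by fun_prop).continuousAt
    simpa using hs
  obtain ⟨e, he⟩ := exists_disc_subset_zero hϖ h
  refine ⟨e, fun e' hee => ?_⟩
  rw [disc_eq_image, Set.image_subset_iff]
  exact (disc_anti 0 ϖ hee).trans he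

lemma disc_mem_nhds (a : K) {c : K} (hc : c ≠ 0) : disc a c ∈ 𝓝 a :=
  (isOpen_disc a hc).mem_nhds (self_mem_disc a c)

lemma hasBasis_nhds_disc (hϖ : Irreducible ϖ) (x : K) :
    (𝓝 x).HasBasis (fun _ : ℕ => True) fun e => disc x ((ϖ : K) ^ e) := by
  refine ⟨fun s => ⟨fun hs => ?_, fun ⟨e, _, h⟩ =>
    mem_of_superset (disc_mem_nhds x (pow_ne_zero e (uniformizer_ne_zero hϖ))) h⟩⟩
  obtain ⟨e, he⟩ := exists_disc_subset hϖ hs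
  exact ⟨e, trivial, he e le_rfl⟩

/-- Makes continuous functions on `K × K` measurable for the product σ-algebra. Discs give countable
bases of neighbourhoods, hence pseudometrizability, and `K` is the union of the compact discs `ϖ ^
(-e) 𝒪`. -/
instance secondCountable : SecondCountableTopology K := by
  obtain ⟨ϖ, hϖ⟩ := IsDiscreteValuationRing.exists_irreducible 𝒪[K]
  let := IsTopologicalAddGroup.rightUniformSpace K
  have := isUniformAddGroup_of_addCommGroup (G := K)
  have : (𝓝 (0 : K)).IsCountablyGenerated := (hasBasis_nhds_disc hϖ 0).isCountablyGenerated
  have : (uniformity K).IsCountablyGenerated := IsUniformAddGroup.uniformity_countably_generated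
  let := TopologicalSpace.pseudoMetrizableSpacePseudoMetric K
  have : SigmaCompactSpace K := by
    refine ⟨⟨fun e : ℕ => disc 0 ((ϖ : K) ^ e)⁻¹, fun e => isCompact_disc _ _, ?_⟩⟩
    refine Set.eq_univ_of_forall fun x => Set.mem_iUnion.2 ?_
    rcases eq_or_ne x 0 with rfl | hx
    · exact ⟨0, self_mem_disc _ _⟩
    refine ⟨(-ord x).toNat, ?_⟩
    have h0 := pow_ne_zero (-ord x).toNat (uniformizer_ne_zero hϖ)
    rw [mem_disc (inv_ne_zero h0), ← ord_nonneg_iff (by simpa [hx] using h0), sub_zero,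
      div_inv_eq_mul, ord_mul hx h0, ord_uniformizer_pow hϖ]
    have := Int.self_le_toNat (-ord x)
    omega
  infer_instance

end Discs

/-! ### Haar measure of discs and affine changes of variable -/

section DiscMeasure

variable {K : Type*} [Field K] [ValuativeRel K] [TopologicalSpace K]
  [IsNonarchimedeanLocalField K] [MeasurableSpace K] [BorelSpace K]

lemma measurableSet_integers : MeasurableSet (𝒪[K] : Set K) :=
  isOpen_integers.measurableSet

variable (μ : Measure K) [μ.IsAddHaarMeasure]

/-- The push-forward of `μ` under multiplication by `c` is again Haar, so it is `r • μ`; evaluating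
on `c 𝒪` gives `r * μ (c 𝒪) = 1`, which identifies the Jacobian. -/
lemma setIntegral_disc (hμ : μ (𝒪[K] : Set K) = 1) (a : K) {c : K} (hc : c ≠ 0) (φ : K → ℂ) :
    ∫ x in disc a c, φ x ∂μ = μ.real (disc 0 c) * ∫ z in (𝒪[K] : Set K), φ (a + c * z) ∂μ := by
  let e : K ≃ₜ K := (Homeomorph.mulLeft₀ c hc).trans (Homeomorph.addLeft a)
  have he : ∀ z, e z = a + c * z := fun z => rfl
  let e₀ : K ≃+ K := { Equiv.mulLeft₀ c hc with map_add' := mul_add c }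
  have h1 : (μ.map e₀).IsAddHaarMeasure :=
    e₀.isAddHaarMeasure_map μ (by exact continuous_const_mul c) 
      (by exact continuous_const_mul c⁻¹)
  have h2 := Measure.isAddLeftInvariant_eq_smul (μ.map e₀) μ
  set r := Measure.addHaarScalarFactor (μ.map e₀) μ
  have hr : 1 = (r : ENNReal) * μ (disc 0 c) := by
    have h3 := congrArg (fun ν => ν (disc 0 c)) h2
    rw [Measure.map_apply (by exact (continuous_const_mul c).measurable)
      (isOpen_disc 0 hc).measurableSet] at h3
    have : e₀ ⁻¹' disc 0 c = (𝒪[K] : Set K) := by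
      ext x
      change c * x ∈ disc 0 c ↔ _
      simp [mem_disc hc, hc]
    rw [this, hμ] at h3
    simpa using h3
  have hmap : ∫ z in (𝒪[K] : Set K), φ (a + c * z) ∂μ = r * ∫ x in disc a c, φ x ∂μ := by
    have h4 : ∫ z in (𝒪[K] : Set K), φ (a + c * z) ∂μ
        = ∫ z in e ⁻¹' disc a c, φ (e z) ∂μ := by
      congr 2
      ext x
      simp [he, mem_disc hc, hc]
    rw [h4, ← e.measurableEmbedding.setIntegral_map]
    have h5 : μ.map e = r • μ := by
      rw [← map_add_left_eq_self (r • μ) a, ← h2, 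
        Measure.map_map (by fun_prop) (by exact (continuous_const_mul c).measurable)]
      rfl
    rw [h5, Measure.restrict_smul, integral_smul_nnreal_measure]
    simp [NNReal.smul_def]
  rw [hmap, ← mul_assoc]
  have : (μ.real (disc 0 c) : ℂ) * (r : ℝ) = 1 := by
    rw [← Complex.ofReal_mul, mul_comm]
    have := congrArg ENNReal.toReal hr
    rw [ENNReal.toReal_mul] at this
    simp only [ENNReal.toReal_one, ENNReal.coe_toReal] at this
    rw [Measure.real, ← this]
    simp
  rw [this, one_mul]

lemma measure_disc_eq (a c : K) : μ (disc a c) = μ (disc 0 c) := by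
  rw [disc_eq_image, Set.image_add_left, measure_preimage_add]

lemma measureReal_disc_mul (hμ : μ (𝒪[K] : Set K) = 1) {c d : K} (hc : c ≠ 0) (hd : d ≠ 0)
    (hdO : d ∈ 𝒪[K]) :
    μ.real (disc 0 (c * d)) = μ.real (disc 0 c) * μ.real (disc 0 d) := by
  have h := setIntegral_disc μ hμ 0 hc ((disc 0 (c * d)).indicator fun _ => (1 : ℂ))
  have h1 : (fun z : K => (disc 0 (c * d)).indicator (fun _ => (1 : ℂ)) (0 + c * z))
      = (disc 0 d).indicator fun _ => (1 : ℂ) := by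
    ext z
    have h2 : 0 + c * z ∈ disc 0 (c * d) ↔ z ∈ disc 0 d := by
      rw [mem_disc (mul_ne_zero hc hd), mem_disc hd, zero_add, sub_zero, sub_zero,
        mul_div_mul_left _ _ hc]
    by_cases hz : z ∈ disc 0 d
    · rw [Set.indicator_of_mem (h2.2 hz), Set.indicator_of_mem hz]
    · rw [Set.indicator_of_notMem (mt h2.1 hz), Set.indicator_of_notMem hz]
  have h2 : disc 0 (c * d) ⊆ disc (0 : K) c := by
    rintro _ ⟨z, hz, rfl⟩
    exact ⟨d * z, mul_mem hdO hz, by ring⟩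
  rw [h1, setIntegral_indicator (isOpen_disc 0 (mul_ne_zero hc hd)).measurableSet,
    setIntegral_indicator (isOpen_disc 0 hd).measurableSet, Set.inter_eq_right.2 h2,
    Set.inter_eq_right.2 (disc_subset_integers (zero_mem _) hdO)] at h
  simpa [← Complex.ofReal_mul, Measure.real] using h

/-- The ring of integers is the disjoint union of `q` translates of `ϖ 𝒪`, one for each residue
class, all of the same measure. -/
lemma measureReal_disc_uniformizer (hμ : μ (𝒪[K] : Set K) = 1) {ϖ : 𝒪[K]} (hϖ : Irreducible ϖ) :
    μ.real (disc 0 (ϖ : K)) = (residueCard K : ℝ)⁻¹ := by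
  have h0 := uniformizer_ne_zero hϖ
  choose r hr using IsLocalRing.residue_surjective (R := 𝒪[K])
  have hcover : (𝒪[K] : Set K) = ⋃ a : 𝓀[K], disc (r a : K) (ϖ : K) := by
    ext x
    simp only [SetLike.mem_coe, Set.mem_iUnion]
    constructor
    · intro hx
      refine ⟨IsLocalRing.residue 𝒪[K] ⟨x, hx⟩, ?_⟩
      have h1 : (⟨x, hx⟩ : 𝒪[K]) - r (IsLocalRing.residue 𝒪[K] ⟨x, hx⟩)
          ∈ IsLocalRing.maximalIdeal 𝒪[K] := by
        rw [← IsLocalRing.residue_eq_zero_iff, map_sub, hr, sub_self]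
      rw [hϖ.maximalIdeal_eq] at h1
      obtain ⟨c, hc⟩ := Ideal.mem_span_singleton.1 h1
      refine ⟨c, c.2, ?_⟩
      have := congrArg Subtype.val hc
      simp only [AddSubgroupClass.coe_sub, Subring.coe_mul] at this
      change _ + (ϖ : K) * _ = x
      linear_combination -this
    · rintro ⟨a, ha⟩
      exact disc_subset_integers (r a).2 ϖ.2 ha
  have hdisj : Pairwise (Function.onFun Disjoint fun a : 𝓀[K] => disc (r a : K) (ϖ : K)) := by
    intro a b hab
    refine Set.disjoint_left.2 ?_
    rintro x ⟨z, hz, rfl⟩ ⟨w, hw, h⟩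
    apply hab
    rw [← hr a, ← hr b, ← sub_eq_zero, ← map_sub, IsLocalRing.residue_eq_zero_iff,
      hϖ.maximalIdeal_eq, Ideal.mem_span_singleton]
    refine ⟨⟨w, hw⟩ - ⟨z, hz⟩, Subtype.ext ?_⟩
    simp only [AddSubgroupClass.coe_sub, Subring.coe_mul] at h ⊢
    linear_combination -h
  have h1 := measure_iUnion (μ := μ) hdisj fun a => (isOpen_disc _ h0).measurableSet
  rw [← hcover, hμ] at h1
  simp only [measure_disc_eq μ (r _ : K)] at h1
  rw [ENNReal.tsum_const] at h1
  have h2 := congrArg ENNReal.toReal h1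
  rw [ENNReal.toReal_mul, ENat.card_eq_coe_natCard] at h2
  simp only [ENNReal.toReal_one, ENat.toENNReal_coe, ENNReal.toReal_natCast] at h2
  exact eq_inv_of_mul_eq_one_right h2.symm

lemma measureReal_disc_pow (hμ : μ (𝒪[K] : Set K) = 1) {ϖ : 𝒪[K]} (hϖ : Irreducible ϖ) (e : ℕ) :
    μ.real (disc 0 ((ϖ : K) ^ e)) = (residueCard K : ℝ)⁻¹ ^ e := by
  induction e with
  | zero => simp [disc_zero_one, Measure.real, hμ]
  | succ e ih =>
    rw [pow_succ, measureReal_disc_mul μ hμ (pow_ne_zero e (uniformizer_ne_zero hϖ))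
      (uniformizer_ne_zero hϖ) ϖ.2, ih, measureReal_disc_uniformizer μ hμ hϖ, pow_succ]

lemma setIntegral_disc_pow (hμ : μ (𝒪[K] : Set K) = 1) {ϖ : 𝒪[K]} (hϖ : Irreducible ϖ)
    (a : K) (e : ℕ) (φ : K → ℂ) :
    ∫ x in disc a ((ϖ : K) ^ e), φ x ∂μ
      = (residueCard K : ℂ)⁻¹ ^ e * ∫ z in (𝒪[K] : Set K), φ (a + (ϖ : K) ^ e * z) ∂μ := by
  rw [setIntegral_disc μ hμ a (pow_ne_zero e (uniformizer_ne_zero hϖ)),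
    measureReal_disc_pow μ hμ hϖ]
  push_cast
  rfl

lemma disc_unit {u : K} (hu : u ∈ 𝒪[K]) (hu' : u⁻¹ ∈ 𝒪[K]) (hu0 : u ≠ 0) :
    disc 0 u = (𝒪[K] : Set K) := by
  refine (disc_subset_integers (zero_mem _) hu).antisymm fun x hx => ?_
  rw [mem_disc hu0, sub_zero, div_eq_mul_inv]
  exact mul_mem hx hu'

lemma setIntegral_unit_mul (hμ : μ (𝒪[K] : Set K) = 1) {u : K} (hu : u ∈ 𝒪[K])
    (hu' : u⁻¹ ∈ 𝒪[K]) (hu0 : u ≠ 0) (φ : K → ℂ) :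
    ∫ z in (𝒪[K] : Set K), φ (u * z) ∂μ = ∫ z in (𝒪[K] : Set K), φ z ∂μ := by
  have h := setIntegral_disc μ hμ 0 hu0 φ
  rw [disc_unit hu hu' hu0] at h
  simpa [Measure.real, hμ] using h.symm

lemma setIntegral_add_left {a : K} (ha : a ∈ 𝒪[K]) (φ : K → ℂ) :
    ∫ z in (𝒪[K] : Set K), φ (a + z) ∂μ = ∫ z in (𝒪[K] : Set K), φ z ∂μ := by
  rw [← integral_indicator measurableSet_integers, ← integral_indicator measurableSet_integers,
    ← integral_add_left_eq_self ((𝒪[K] : Set K).indicator φ) a]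
  congr 1
  ext z
  have h : a + z ∈ (𝒪[K] : Set K) ↔ z ∈ (𝒪[K] : Set K) := add_mem_cancel_left ha
  by_cases hz : z ∈ (𝒪[K] : Set K)
  · rw [Set.indicator_of_mem (h.2 hz), Set.indicator_of_mem hz]
  · rw [Set.indicator_of_notMem (mt h.1 hz), Set.indicator_of_notMem hz]

end DiscMeasure

/-! ### Functions of `t` with a prescribed denominator -/

section RationalFunctions

/-- The punctured open unit disc, in which `q ^ (-s)` ranges for `Re s > 0`. -/
abbrev PuncturedDisc : Type := {t : ℂ // t ≠ 0 ∧ ‖t‖ < 1}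

/-- The functions on the punctured unit disc that become polynomial after multiplication by `D`. -/
def polynomialOver (D : ℂ[X]) : Submodule ℂ (PuncturedDisc → ℂ) where
  carrier := {φ | ∃ G : ℂ[X], ∀ t : PuncturedDisc, D.eval (t : ℂ) * φ t = G.eval (t : ℂ)}
  add_mem' := by
    rintro φ ψ ⟨G, hG⟩ ⟨H, hH⟩
    exact ⟨G + H, fun t => by simp [mul_add, hG, hH]⟩
  zero_mem' := ⟨0, fun t => by simp⟩
  smul_mem' := by
    rintro c φ ⟨G, hG⟩
    exact ⟨C c * G, fun t => by simp [← hG, mul_left_comm]⟩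

lemma polynomialOver_mono {D D' : ℂ[X]} (h : D ∣ D') : polynomialOver D ≤ polynomialOver D' := by
  obtain ⟨E, rfl⟩ := h
  rintro φ ⟨G, hG⟩
  exact ⟨G * E, fun t => by simp [← hG, mul_right_comm]⟩

lemma eval_mul_mem_polynomialOver {D : ℂ[X]} {φ : PuncturedDisc → ℂ} (hφ : φ ∈ polynomialOver D)
    (P : ℂ[X]) : (fun t : PuncturedDisc => P.eval (t : ℂ) * φ t) ∈ polynomialOver D := by
  obtain ⟨G, hG⟩ := hφ
  exact ⟨P * G, fun t => by simp [← hG, mul_left_comm]⟩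

lemma eval_mem_polynomialOver (D P : ℂ[X]) :
    (fun t : PuncturedDisc => P.eval (t : ℂ)) ∈ polynomialOver D :=
  ⟨D * P, fun t => by simp⟩

lemma const_mem_polynomialOver (D : ℂ[X]) (c : ℂ) :
    (fun _ : PuncturedDisc => c) ∈ polynomialOver D := by
  simpa using eval_mem_polynomialOver D (C c)

lemma mem_polynomialOver_mul {D D' : ℂ[X]} {φ : PuncturedDisc → ℂ}
    (h : (fun t : PuncturedDisc => D'.eval (t : ℂ) * φ t) ∈ polynomialOver D) :
    φ ∈ polynomialOver (D * D') := by
  obtain ⟨G, hG⟩ := h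
  exact ⟨G, fun t => by simp [← hG, mul_assoc]⟩

end RationalFunctions

/-! ### Integrals of locally constant families -/

section LocallyConstant

open Filter Topology

/-- A locally constant map on a compact set has finitely many values, so its integral is a finite
linear combination of them. Taking values in functions of `t` makes the decomposition independent of
`t`. -/
lemma setIntegral_mem_of_locallyConstant {X ι : Type*} [TopologicalSpace X] [MeasurableSpace X]
    [OpensMeasurableSpace X] (ν : Measure X) [IsFiniteMeasureOnCompacts ν]
    (W : Submodule ℂ (ι → ℂ)) {S : Set X} (hS : IsCompact S) (hSm : MeasurableSet S)
    (Φ : X → ι → ℂ) (hloc : ∀ x ∈ S, ∀ᶠ y in 𝓝[S] x, Φ y = Φ x) (hW : ∀ x ∈ S, Φ x ∈ W) :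
    (fun t => ∫ x in S, Φ x t ∂ν) ∈ W := by
  classical
  have hlc : IsLocallyConstant (S.domRestrict Φ) := by
    refine (IsLocallyConstant.iff_eventually_eq _).2 fun x => ?_
    exact (eventually_nhds_subtype_iff S x fun y => Φ y = Φ x).2 (hloc x x.2)
  have : CompactSpace S := isCompact_iff_compactSpace.1 hS
  have hfin : (Φ '' S).Finite := by
    rw [← Set.range_domRestrict]
    exact hlc.range_finite
  have hmeas : ∀ v, MeasurableSet (S ∩ Φ ⁻¹' {v}) := by
    intro v
    obtain ⟨U, hU, hUv⟩ := isOpen_induced_iff.1 (hlc.isOpen_fiber v)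
    have : S ∩ Φ ⁻¹' {v} = S ∩ U := by
      ext x
      refine and_congr_right fun hx => ?_
      exact (Set.ext_iff.1 hUv ⟨x, hx⟩).symm
    rw [this]
    exact hSm.inter hU.measurableSet
  have hunion : S = ⋃ v ∈ hfin.toFinset, S ∩ Φ ⁻¹' {v} := by
    ext x
    simp only [Set.mem_iUnion, Set.mem_inter_iff, Set.mem_preimage, Set.mem_singleton_iff,
      Set.Finite.mem_toFinset, exists_prop]
    exact ⟨fun hx => ⟨Φ x, ⟨x, hx, rfl⟩, hx, rfl⟩, fun ⟨v, _, hx, _⟩ => hx⟩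
  have hlt : ∀ v, ν (S ∩ Φ ⁻¹' {v}) ≠ ⊤ := fun v =>
    ((measure_mono Set.inter_subset_left).trans_lt hS.measure_lt_top).ne
  have key : (fun t => ∫ x in S, Φ x t ∂ν)
      = ∑ v ∈ hfin.toFinset, (ν.real (S ∩ Φ ⁻¹' {v}) : ℂ) • v := by
    ext t
    have hcongr : ∀ v, Set.EqOn (fun x => Φ x t) (fun _ => v t) (S ∩ Φ ⁻¹' {v}) :=
      fun v x hx => congrFun hx.2 t
    conv_lhs => rw [hunion]
    rw [integral_biUnion_finset _ fun v _ => hmeas v]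
    · rw [Finset.sum_apply]
      refine Finset.sum_congr rfl fun v _ => ?_
      rw [setIntegral_congr_fun (hmeas v) (hcongr v), setIntegral_const]
      simp
    · intro v _ w _ hvw
      refine Set.disjoint_left.2 fun x hx hx' => hvw ?_
      exact hx.2.symm.trans hx'.2
    · intro v _
      exact (integrableOn_congr_fun (hcongr v) (hmeas v)).2 (integrableOn_const (hlt v))
  rw [key]
  refine W.sum_mem fun v hv => W.smul_mem _ ?_
  obtain ⟨x, hx, rfl⟩ := hfin.mem_toFinset.1 hv
  exact hW x hx

variable {K : Type*} [Field K] [ValuativeRel K] [TopologicalSpace K]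
  [IsNonarchimedeanLocalField K] [MeasurableSpace K] [BorelSpace K]

/-- Cut a small disc out around each exceptional point; what remains is compact and open, and the
previous lemma applies to it. This reduces rationality to a local statement at the zeros. -/
lemma setIntegral_mem_of_locallyConstant_compl_finset (μ : Measure K) [μ.IsAddHaarMeasure]
    {ϖ : 𝒪[K]} (hϖ : Irreducible ϖ) {ι : Type*} (W : Submodule ℂ (ι → ℂ)) (Φ : K → ι → ℂ)
    (P : Finset K) {S : Set K} (hS : IsCompact S) (hSo : IsOpen S)
    (hinteg : ∀ t, IntegrableOn (fun x => Φ x t) S μ)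
    (hloc : ∀ x ∈ S, x ∉ P → ∀ᶠ y in 𝓝 x, Φ y = Φ x) (hW : ∀ x ∈ S, x ∉ P → Φ x ∈ W)
    (hP : ∀ x ∈ P, x ∈ S → ∃ e₀ : ℕ, ∀ e ≥ e₀,
      (fun t => ∫ y in disc x ((ϖ : K) ^ e), Φ y t ∂μ) ∈ W) :
    (fun t => ∫ x in S, Φ x t ∂μ) ∈ W := by
  classical
  induction P using Finset.induction_on generalizing S with
  | empty =>
    exact setIntegral_mem_of_locallyConstant μ W hS hSo.measurableSet Φ
      (fun x hx => (hloc x hx (Finset.notMem_empty x)).filter_mono nhdsWithin_le_nhds)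
      fun x hx => hW x hx (Finset.notMem_empty x)
  | insert a P ha ih =>
    by_cases haS : a ∈ S
    · obtain ⟨e₀, he₀⟩ := hP a (Finset.mem_insert_self a P) haS
      obtain ⟨e₁, he₁⟩ := exists_disc_subset hϖ (hSo.mem_nhds haS)
      set D := disc a ((ϖ : K) ^ max e₀ e₁)
      have hc := pow_ne_zero (max e₀ e₁) (uniformizer_ne_zero hϖ)
      have hDo : IsOpen D := isOpen_disc a hc
      have hDS : D ⊆ S := he₁ _ (le_max_right _ _)
      have hDW := he₀ _ (le_max_left e₀ e₁)
      have hne : ∀ x ∈ S \ D, x ∉ P → x ∉ insert a P := by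
        intro x hx hxP h
        rcases Finset.mem_insert.1 h with rfl | h
        · exact hx.2 (self_mem_disc _ _)
        · exact hxP h
      have hrest := ih (S := S \ D) (hS.diff hDo) (hSo.sdiff (isCompact_disc _ _).isClosed)
        (fun t => (hinteg t).mono_set Set.sdiff_subset)
        (fun x hx hxP => hloc x hx.1 (hne x hx hxP)) (fun x hx hxP => hW x hx.1 (hne x hx hxP))
        (fun x hx hxS => hP x (Finset.mem_insert_of_mem hx) hxS.1)
      have : (fun t => ∫ x in S, Φ x t ∂μ)
          = (fun t => ∫ x in S \ D, Φ x t ∂μ) + fun t => ∫ x in D, Φ x t ∂μ := by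
        ext t
        rw [Pi.add_apply, ← setIntegral_union Set.disjoint_sdiff_left hDo.measurableSet
          ((hinteg t).mono_set Set.sdiff_subset) ((hinteg t).mono_set hDS),
          Set.sdiff_union_of_subset hDS]
      rw [this]
      exact W.add_mem hrest hDW
    · have hne : ∀ x ∈ S, x ∉ P → x ∉ insert a P := by
        intro x hx hxP h
        rcases Finset.mem_insert.1 h with rfl | h
        · exact haS hx
        · exact hxP h
      exact ih hS hSo hinteg (fun x hx hxP => hloc x hx (hne x hx hxP))
        (fun x hx hxP => hW x hx (hne x hx hxP))
        fun x hx hxS => hP x (Finset.mem_insert_of_mem hx) hxS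

end LocallyConstant

/-! ### Conductors and quasi-characters -/

section Characters

open Filter Topology

/-- `ℂˣ` has no small subgroups. -/
lemma eq_one_of_forall_norm_pow_two_pow_sub_one_lt {z : ℂ}
    (h : ∀ k : ℕ, ‖z ^ 2 ^ k - 1‖ < 1 / 2) : z = 1 := by
  by_contra hz
  have hpos : 0 < ‖z - 1‖ := norm_pos_iff.2 (sub_ne_zero.2 hz)
  -- Squaring pushes away from `1`: `w ^ 2 - 1 = (w - 1) (w + 1)`, and `‖w + 1‖ ≥ 3 / 2` while `w`
  -- stays within `1 / 2` of `1`.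
  have hgrow : ∀ k : ℕ, (3 / 2 : ℝ) ^ k * ‖z - 1‖ ≤ ‖z ^ 2 ^ k - 1‖ := by
    intro k
    induction k with
    | zero => simp
    | succ k ih =>
      set w := z ^ 2 ^ k
      have h1 : z ^ 2 ^ (k + 1) - 1 = (w - 1) * (2 + (w - 1)) := by
        simp only [w, pow_succ, pow_mul]; ring
      have h2 : (3 / 2 : ℝ) ≤ ‖2 + (w - 1)‖ := by
        have h3 := norm_sub_le (2 + (w - 1)) (w - 1)
        rw [add_sub_cancel_right] at h3
        have h4 := h k
        norm_num at h3
        linarith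
      rw [h1, norm_mul, pow_succ]
      nlinarith [norm_nonneg (w - 1)]
  obtain ⟨k, hk⟩ := pow_unbounded_of_one_lt (‖z - 1‖)⁻¹ (by norm_num : (1 : ℝ) < 3 / 2)
  have h1 := hgrow k
  have h2 := h k
  have h3 : 1 < (3 / 2 : ℝ) ^ k * ‖z - 1‖ := by
    rwa [inv_lt_iff_one_lt_mul₀ hpos] at hk
  linarith

variable {K : Type*} [Field K] [ValuativeRel K] [TopologicalSpace K]
  [IsNonarchimedeanLocalField K] {ϖ : 𝒪[K]}

lemma mem_integers_of_mem_disc_one {N : ℕ} {x : K} (hx : x ∈ disc 1 ((ϖ : K) ^ N)) : x ∈ 𝒪[K] :=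
  disc_subset_integers (one_mem _) (pow_mem ϖ.2 _) hx

lemma ne_zero_and_ord_eq_zero_of_mem_disc_one (hϖ : Irreducible ϖ) {N : ℕ} (hN : 1 ≤ N) {x : K}
    (hx : x ∈ disc 1 ((ϖ : K) ^ N)) : x ≠ 0 ∧ ord x = 0 := by
  have key : x ∉ disc 0 ((ϖ : K) ^ 1) := by
    intro h
    obtain ⟨z, hz, h1⟩ := disc_anti 1 ϖ hN hx
    obtain ⟨w, hw, h2⟩ := h
    have h3 : (1 : K) ∈ disc 0 ((ϖ : K) ^ 1) := ⟨w - z, sub_mem hw hz, by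
      simp only at h1 h2; linear_combination h2 - h1⟩
    have h4 := (mem_disc_zero_iff_ord hϖ one_ne_zero 1).1 h3
    rw [ord_one] at h4
    norm_num at h4
  have hx0 : x ≠ 0 := by
    rintro rfl
    exact key (self_mem_disc _ _)
  refine ⟨hx0, ?_⟩
  have h1 := (ord_nonneg_iff hx0).2 (mem_integers_of_mem_disc_one hx)
  rw [mem_disc_zero_iff_ord hϖ hx0] at key
  push_cast at key
  omega

lemma mul_mem_disc_one {N : ℕ} {x y : K} (hx : x ∈ disc 1 ((ϖ : K) ^ N))
    (hy : y ∈ disc 1 ((ϖ : K) ^ N)) : x * y ∈ disc 1 ((ϖ : K) ^ N) := by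
  obtain ⟨z, hz, rfl⟩ := hx
  obtain ⟨w, hw, rfl⟩ := hy
  exact ⟨z + w + (ϖ : K) ^ N * z * w, add_mem (add_mem hz hw)
    (mul_mem (mul_mem (pow_mem ϖ.2 _) hz) hw), by simp only; ring⟩

lemma one_mem_disc_one (N : ℕ) : (1 : K) ∈ disc 1 ((ϖ : K) ^ N) := self_mem_disc _ _

lemma pow_mem_disc_one {N : ℕ} {x : K} (hx : x ∈ disc 1 ((ϖ : K) ^ N)) (k : ℕ) :
    x ^ k ∈ disc 1 ((ϖ : K) ^ N) := by
  induction k with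
  | zero => simpa using one_mem_disc_one N
  | succ k ih => rw [pow_succ]; exact mul_mem_disc_one ih hx

lemma isClosedEmbedding_unitsVal :
    IsClosedEmbedding fun u : (𝒪[K])ˣ => ((u : 𝒪[K]) : K) := by
  have : CompactSpace 𝒪[K] := inferInstance
  refine Continuous.isClosedEmbedding (by fun_prop) ?_
  exact Subtype.val_injective.comp Units.val_injective

/-- By continuity `χ` maps some `1 + ϖ ^ N 𝒪` into a small ball around `1`. This set is closed under
powers, so all powers of each value stay in the ball, which forces the value to be `1`. -/
lemma exists_conductor (hϖ : Irreducible ϖ) (χ : (𝒪[K])ˣ →* ℂˣ) (hχ : Continuous χ) :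
    ∃ N : ℕ, 1 ≤ N ∧
      ∀ u : (𝒪[K])ˣ, ((u : 𝒪[K]) : K) ∈ disc 1 ((ϖ : K) ^ N) → χ u = 1 := by
  have hc : Continuous fun u : (𝒪[K])ˣ => (χ u : ℂ) := Units.continuous_val.comp hχ
  have hU : (fun u : (𝒪[K])ˣ => (χ u : ℂ)) ⁻¹' Metric.ball 1 (1 / 2) ∈ 𝓝 (1 : (𝒪[K])ˣ) := by
    apply hc.continuousAt
    change _ ∈ 𝓝 (χ 1 : ℂ)
    rw [map_one, Units.val_one]
    exact Metric.ball_mem_nhds _ (by norm_num)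
  rw [isClosedEmbedding_unitsVal.isInducing.nhds_eq_comap, mem_comap] at hU
  obtain ⟨s, hs, hsU⟩ := hU
  simp only [Units.val_one, OneMemClass.coe_one] at hs
  obtain ⟨e, he⟩ := exists_disc_subset hϖ hs
  -- `e + 1` in place of `e` secures `1 ≤ N`, so that `1 + ϖ ^ N 𝒪` consists of units.
  refine ⟨e + 1, by omega, fun u hu => Units.ext ?_⟩
  rw [Units.val_one]
  refine eq_one_of_forall_norm_pow_two_pow_sub_one_lt fun k => ?_
  have h1 : u ^ 2 ^ k ∈ (fun u : (𝒪[K])ˣ => ((u : 𝒪[K]) : K)) ⁻¹' s := by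
    refine he (e + 1) (by omega) ?_
    simpa using pow_mem_disc_one hu (2 ^ k)
  have h2 := hsU h1
  simpa [dist_eq_norm] using h2

lemma exists_norm_le (χ : (𝒪[K])ˣ →* ℂˣ) (hχ : Continuous χ) :
    ∃ B : ℝ, ∀ u : (𝒪[K])ˣ, ‖(χ u : ℂ)‖ ≤ B := by
  have hc : Continuous fun u : (𝒪[K])ˣ => (χ u : ℂ) := Units.continuous_val.comp hχ
  obtain ⟨B, hB⟩ := isCompact_univ.exists_bound_of_continuousOn hc.continuousOn
  exact ⟨B, fun u => hB u (Set.mem_univ u)⟩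

lemma charAC_eq (hϖ : Irreducible ϖ) (χ : (𝒪[K])ˣ →* ℂˣ) {x : K} (hx : x ≠ 0) {u : (𝒪[K])ˣ}
    (hu : x = ((u : 𝒪[K]) : K) * (ϖ : K) ^ ord x) : charAC ϖ χ x = χ u := by
  have h : ∃ u : (𝒪[K])ˣ, x = ((u : 𝒪[K]) : K) * (ϖ : K) ^ ord x := ⟨u, hu⟩
  unfold charAC
  rw [dif_pos h, (existsUnique_angular hϖ hx).unique h.choose_spec hu]

lemma charAC_mul (hϖ : Irreducible ϖ) (χ : (𝒪[K])ˣ →* ℂˣ) (x y : K) :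
    charAC ϖ χ (x * y) = charAC ϖ χ x * charAC ϖ χ y := by
  rcases eq_or_ne x 0 with rfl | hx
  · rw [zero_mul, charAC_zero ϖ hϖ, zero_mul]
  rcases eq_or_ne y 0 with rfl | hy
  · rw [mul_zero, charAC_zero ϖ hϖ, mul_zero]
  obtain ⟨u, hu, -⟩ := existsUnique_angular hϖ hx
  obtain ⟨v, hv, -⟩ := existsUnique_angular hϖ hy
  rw [charAC_eq hϖ χ hx hu, charAC_eq hϖ χ hy hv, charAC_eq (u := u * v) hϖ χ (mul_ne_zero hx hy)]
  · simp
  · rw [ord_mul hx hy, zpow_add₀ (uniformizer_ne_zero hϖ)]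
    conv_lhs => rw [hu, hv]
    push_cast
    ring

/-- The quasi-character `x ↦ χ (ac x) t ^ ord x` of `Kˣ`, extended by zero. -/
noncomputable def quasiChar (hϖ : Irreducible ϖ) (χ : (𝒪[K])ˣ →* ℂˣ) (t : PuncturedDisc) :
    K →*₀ ℂ where
  toFun x := charAC ϖ χ x * (t : ℂ) ^ ord x
  map_zero' := by rw [charAC_zero ϖ hϖ, zero_mul]
  map_one' := by
    rw [charAC_eq (u := 1) hϖ χ one_ne_zero (by simp [ord_one])]
    simp [ord_one]
  map_mul' x y := by
    rw [charAC_mul hϖ]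
    rcases eq_or_ne x 0 with rfl | hx
    · simp [charAC_zero ϖ hϖ]
    rcases eq_or_ne y 0 with rfl | hy
    · simp [charAC_zero ϖ hϖ]
    rw [ord_mul hx hy, zpow_add₀ t.2.1]
    ring

lemma quasiChar_apply (hϖ : Irreducible ϖ) (χ : (𝒪[K])ˣ →* ℂˣ) (t : PuncturedDisc) (x : K) :
    quasiChar hϖ χ t x = charAC ϖ χ x * (t : ℂ) ^ ord x := rfl

lemma quasiChar_uniformizer (hϖ : Irreducible ϖ) (χ : (𝒪[K])ˣ →* ℂˣ) (t : PuncturedDisc) :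
    quasiChar hϖ χ t (ϖ : K) = t := by
  rw [quasiChar_apply, charAC_eq (u := 1) hϖ χ (uniformizer_ne_zero hϖ)]
  · simp [ord_uniformizer hϖ]
  · simp [ord_uniformizer hϖ]

lemma quasiChar_of_ord_eq_zero (hϖ : Irreducible ϖ) (χ : (𝒪[K])ˣ →* ℂˣ) (t : PuncturedDisc)
    {x : K} (hx : ord x = 0) : quasiChar hϖ χ t x = charAC ϖ χ x := by
  simp [quasiChar_apply, hx]

lemma exists_quasiChar_eq_one (hϖ : Irreducible ϖ) (χ : (𝒪[K])ˣ →* ℂˣ) (hχ : Continuous χ) :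
    ∃ N : ℕ, 1 ≤ N ∧ ∀ t, ∀ x ∈ disc (1 : K) ((ϖ : K) ^ N), quasiChar hϖ χ t x = 1 := by
  obtain ⟨N, hN, h⟩ := exists_conductor hϖ χ hχ
  refine ⟨N, hN, fun t x hx => ?_⟩
  obtain ⟨hx0, hord⟩ := ne_zero_and_ord_eq_zero_of_mem_disc_one hϖ hN hx
  obtain ⟨u, rfl⟩ := exists_unit_of_ord_eq_zero hx0 hord
  rw [quasiChar_of_ord_eq_zero hϖ χ t hord, charAC_eq (u := u) hϖ χ hx0 (by simp [hord]), h u hx,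
    Units.val_one]

/-- On integers the order is nonnegative and `‖t‖ < 1`, so only the bound for `χ` on the compact
unit group matters. This gives all the integrability used below. -/
lemma exists_norm_quasiChar_le (hϖ : Irreducible ϖ) (χ : (𝒪[K])ˣ →* ℂˣ) (hχ : Continuous χ) :
    ∃ B : ℝ, ∀ t, ∀ x ∈ 𝒪[K], ‖quasiChar hϖ χ t x‖ ≤ B := by
  obtain ⟨B, hB⟩ := exists_norm_le χ hχ
  refine ⟨B, fun t x hx => ?_⟩
  rcases eq_or_ne x 0 with rfl | hx0
  · simpa using (norm_nonneg _).trans (hB 1)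
  obtain ⟨u, hu, -⟩ := existsUnique_angular hϖ hx0
  obtain ⟨k, hk⟩ := Int.eq_ofNat_of_zero_le ((ord_nonneg_iff hx0).2 hx)
  rw [quasiChar_apply, charAC_eq hϖ χ hx0 hu, hk, zpow_natCast, norm_mul,
    norm_pow]
  calc ‖(χ u : ℂ)‖ * ‖(t : ℂ)‖ ^ k ≤ ‖(χ u : ℂ)‖ * 1 := by
        gcongr
        exact pow_le_one₀ (norm_nonneg _) t.2.2.le
    _ ≤ B := by simpa using hB u

lemma eventually_mul_mem_disc_one (hϖ : Irreducible ϖ) {x : K} (hx : x ≠ 0) (N : ℕ) :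
    ∀ᶠ y in 𝓝 x, ∃ v ∈ disc (1 : K) ((ϖ : K) ^ N), y = x * v := by
  have hc := mul_ne_zero hx (pow_ne_zero N (uniformizer_ne_zero hϖ))
  filter_upwards [disc_mem_nhds x hc]
  rintro _ ⟨z, hz, rfl⟩
  exact ⟨1 + (ϖ : K) ^ N * z, ⟨z, hz, rfl⟩, by ring⟩

lemma eventually_quasiChar_eq (hϖ : Irreducible ϖ) (χ : (𝒪[K])ˣ →* ℂˣ) (hχ : Continuous χ)
    {x : K} (hx : x ≠ 0) : ∀ᶠ y in 𝓝 x, ∀ t, quasiChar hϖ χ t y = quasiChar hϖ χ t x := by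
  obtain ⟨N, -, h⟩ := exists_quasiChar_eq_one hϖ χ hχ
  filter_upwards [eventually_mul_mem_disc_one hϖ hx N]
  rintro _ ⟨v, hv, rfl⟩ t
  rw [map_mul, h t v hv, mul_one]

lemma measurable_quasiChar [MeasurableSpace K] [BorelSpace K] (hϖ : Irreducible ϖ)
    (χ : (𝒪[K])ˣ →* ℂˣ) (hχ : Continuous χ) (t : PuncturedDisc) :
    Measurable (quasiChar hϖ χ t) := by
  refine measurable_of_continuousOn_compl_singleton 0 fun x hx => ?_
  refine ContinuousAt.continuousWithinAt ?_
  have h : quasiChar hϖ χ t =ᶠ[𝓝 x] fun _ => quasiChar hϖ χ t x := by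
    filter_upwards [eventually_quasiChar_eq hϖ χ hχ hx] with y hy using hy t
  exact continuousAt_const.congr h.symm

end Characters

/-! ### Extracting `m`-th roots near `1` -/

section Roots

variable {K : Type*} [Field K] [ValuativeRel K] [TopologicalSpace K]
  [IsNonarchimedeanLocalField K] {ϖ : 𝒪[K]}

lemma mem_integers_of_ord_eq_zero {x : K} (hx : x ≠ 0) (h : ord x = 0) : x ∈ 𝒪[K] :=
  (ord_nonneg_iff hx).1 h.ge

lemma inv_mem_integers_of_ord_eq_zero {x : K} (hx : x ≠ 0) (h : ord x = 0) : x⁻¹ ∈ 𝒪[K] :=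
  (ord_nonneg_iff (inv_ne_zero hx)).1 (by rw [ord_inv x, h, neg_zero])

/-- Each of the `m` summands is `1` modulo `ϖ ^ N`, and `m` is a unit. Used to linearize `x ^ m - y
^ m`. -/
lemma geom_sum_of_mem_disc_one {m : ℕ} (hm0 : (m : K) ≠ 0) (hm : ord (m : K) = 0) {N : ℕ} {v : K}
    (hv : v ∈ disc 1 ((ϖ : K) ^ N)) :
    ∃ w ∈ disc (1 : K) ((ϖ : K) ^ N), ∑ i ∈ Finset.range m, v ^ i = m * w := by
  have h : ∀ i : ℕ, ∃ z ∈ 𝒪[K], v ^ i = 1 + (ϖ : K) ^ N * z := fun i => by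
    obtain ⟨z, hz, h⟩ := pow_mem_disc_one hv i
    exact ⟨z, hz, h.symm⟩
  choose z hz h using h
  refine ⟨_, ⟨(m : K)⁻¹ * ∑ i ∈ Finset.range m, z i,
    mul_mem (inv_mem_integers_of_ord_eq_zero hm0 hm) (sum_mem fun i _ => hz i), rfl⟩, ?_⟩
  simp only [h, Finset.sum_add_distrib, ← Finset.mul_sum]
  simp only [Finset.sum_const, Finset.card_range, nsmul_eq_mul, mul_one]
  field_simp

lemma exists_pow_eq_of_mem_disc_one (hϖ : Irreducible ϖ) {m : ℕ} (hm0 : (m : K) ≠ 0)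
    (hm : ord (m : K) = 0) {N : ℕ} (hN : 1 ≤ N) {v : K} (hv : v ∈ disc 1 ((ϖ : K) ^ N)) :
    ∃ w ∈ disc (1 : K) ((ϖ : K) ^ N), w ^ m = v := by
  let := IsTopologicalAddGroup.rightUniformSpace K
  have := isUniformAddGroup_of_addCommGroup (G := K)
  have hmpos : m ≠ 0 := by
    rintro rfl
    simp at hm0
  have hmu : IsUnit (m : 𝒪[K]) := by
    obtain ⟨u, hu⟩ := exists_unit_of_ord_eq_zero hm0 hm
    refine ⟨u, Subtype.ext ?_⟩
    rw [hu]
    rfl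
  have hvO := mem_integers_of_mem_disc_one hv
  have hmax : ∀ x : 𝒪[K], x ∈ IsLocalRing.maximalIdeal 𝒪[K] ↔ (x : K) ∈ disc 0 ((ϖ : K) ^ 1) := by
    intro x
    rw [hϖ.maximalIdeal_eq, Ideal.mem_span_singleton]
    constructor
    · rintro ⟨c, rfl⟩
      exact ⟨c, c.2, by simp⟩
    · rintro ⟨c, hc, h⟩
      exact ⟨⟨c, hc⟩, Subtype.ext (by simpa using h.symm)⟩
  have hens : HenselianRing 𝒪[K] (IsLocalRing.maximalIdeal 𝒪[K]) := inferInstance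
  obtain ⟨a, ha, ha1⟩ := hens.is_henselian (X ^ m - C (⟨v, hvO⟩ : 𝒪[K]))
    (monic_X_pow_sub_C _ hmpos) 1 (by
      rw [hmax]
      obtain ⟨z, hz, h⟩ := disc_anti 1 ϖ hN hv
      refine ⟨-z, neg_mem hz, ?_⟩
      simp only [eval_sub, eval_pow, eval_X, one_pow, eval_C, AddSubgroupClass.coe_sub,
        OneMemClass.coe_one]
      simp only at h
      linear_combination -h) (by
      refine IsUnit.map _ ?_
      simpa [derivative_X_pow] using hmu)
  have ham : (a : K) ^ m = v := by
    have h := congrArg Subtype.val (show a ^ m = ⟨v, hvO⟩ by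
      simpa [IsRoot, sub_eq_zero] using ha)
    simpa using h
  rw [hmax] at ha1
  have ha2 : (a : K) ∈ disc 1 ((ϖ : K) ^ 1) := by
    obtain ⟨z, hz, h⟩ := ha1
    refine ⟨z, hz, ?_⟩
    simp only [AddSubgroupClass.coe_sub, OneMemClass.coe_one] at h ⊢
    linear_combination h
  -- Hensel only gives `a ≡ 1` modulo `ϖ`. Since `v - 1 = a ^ m - 1 = (a - 1) m w` with `m w` a
  -- unit, `a - 1` inherits the divisibility of `v - 1` by `ϖ ^ N`.
  obtain ⟨w, hw, hsum⟩ := geom_sum_of_mem_disc_one hm0 hm ha2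
  obtain ⟨hw0, hword⟩ := ne_zero_and_ord_eq_zero_of_mem_disc_one hϖ le_rfl hw
  obtain ⟨z, hz, hzv⟩ := hv
  refine ⟨a, ⟨z * ((m : K)⁻¹ * w⁻¹), mul_mem hz (mul_mem
    (inv_mem_integers_of_ord_eq_zero hm0 hm) (inv_mem_integers_of_ord_eq_zero hw0 hword)), ?_⟩, ham⟩
  have h := mul_geom_sum (a : K) m
  rw [hsum, ham, ← hzv] at h
  field_simp
  simp only at h
  linear_combination -h

end Roots

/-! ### Self-similarity and one-variable integrals -/

section SingleVariable

open Filter Topology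

variable {K : Type*} [Field K] [ValuativeRel K] [TopologicalSpace K]
  [IsNonarchimedeanLocalField K] [MeasurableSpace K] [BorelSpace K]
  (μ : Measure K) [μ.IsAddHaarMeasure] {ϖ : 𝒪[K]} (hϖ : Irreducible ϖ)
  (χ : (𝒪[K])ˣ →* ℂˣ)

lemma setIntegral_integers_eq_add (hϖ : Irreducible ϖ) (hμ : μ (𝒪[K] : Set K) = 1) (e : ℕ)
    {φ : K → ℂ}
    (hφ : IntegrableOn φ (𝒪[K] : Set K) μ) :
    ∫ z in (𝒪[K] : Set K), φ z ∂μ = ∫ z in (𝒪[K] : Set K) \ disc 0 ((ϖ : K) ^ e), φ z ∂μ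
      + (residueCard K : ℂ)⁻¹ ^ e * ∫ z in (𝒪[K] : Set K), φ ((ϖ : K) ^ e * z) ∂μ := by
  have hsub : disc 0 ((ϖ : K) ^ e) ⊆ (𝒪[K] : Set K) :=
    disc_subset_integers (zero_mem _) (pow_mem ϖ.2 e)
  have h1 := setIntegral_disc_pow μ hμ hϖ 0 e φ
  simp only [zero_add] at h1
  rw [← h1, ← setIntegral_union Set.disjoint_sdiff_left
    (isOpen_disc 0 (pow_ne_zero e (uniformizer_ne_zero hϖ))).measurableSet
    (hφ.mono_set Set.sdiff_subset) (hφ.mono_set hsub), Set.sdiff_union_of_subset hsub]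

lemma setIntegral_integers_diff_disc_mem (hϖ : Irreducible ϖ)
    {ι : Type*} (W : Submodule ℂ (ι → ℂ)) (e : ℕ)
    (Φ : K → ι → ℂ) (hloc : ∀ x ∈ 𝒪[K], x ≠ 0 → ∀ᶠ y in 𝓝 x, Φ y = Φ x)
    (hW : ∀ x ∈ 𝒪[K], x ≠ 0 → Φ x ∈ W) :
    (fun t => ∫ z in (𝒪[K] : Set K) \ disc 0 ((ϖ : K) ^ e), Φ z t ∂μ) ∈ W := by
  have hopen : IsOpen (disc 0 ((ϖ : K) ^ e)) :=
    isOpen_disc 0 (pow_ne_zero e (uniformizer_ne_zero hϖ))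
  have hne : ∀ x ∈ (𝒪[K] : Set K) \ disc 0 ((ϖ : K) ^ e), x ≠ 0 := by
    rintro x hx rfl
    exact hx.2 (self_mem_disc _ _)
  exact setIntegral_mem_of_locallyConstant μ W (isCompact_integers.diff hopen)
    (measurableSet_integers.diff hopen.measurableSet) Φ
    (fun x hx => (hloc x hx.1 (hne x hx)).filter_mono nhdsWithin_le_nhds)
    fun x hx => hW x hx.1 (hne x hx)

/-- The polynomial `1 - q ^ (-a) X ^ b`. -/
noncomputable def denomFactor (q a b : ℕ) : ℂ[X] := 1 - C ((q : ℂ)⁻¹ ^ a) * X ^ b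

lemma eval_denomFactor (q a b : ℕ) (t : ℂ) :
    (denomFactor q a b).eval t = 1 - (q : ℂ)⁻¹ ^ a * t ^ b := by
  simp [denomFactor]

/-- The only source of denominators: solving the relation for `φ` divides `ψ` by `1 - q ^ (-a) t ^
b`. -/
lemma mem_polynomialOver_of_self_similar {D : ℂ[X]} {φ ψ : PuncturedDisc → ℂ} {q a b : ℕ}
    (hψ : ψ ∈ polynomialOver D)
    (h : ∀ t : PuncturedDisc, φ t = ψ t + (q : ℂ)⁻¹ ^ a * (t : ℂ) ^ b * φ t) :
    φ ∈ polynomialOver (D * denomFactor q a b) := by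
  refine mem_polynomialOver_mul ?_
  convert hψ using 1
  ext t
  rw [eval_denomFactor]
  linear_combination h t

lemma quasiChar_mem_polynomialOver (D : ℂ[X]) {x : K} (hx : x ∈ 𝒪[K]) :
    (fun t => quasiChar hϖ χ t x) ∈ polynomialOver D := by
  rcases eq_or_ne x 0 with rfl | hx0
  · simpa using const_mem_polynomialOver D 0
  obtain ⟨k, hk⟩ := Int.eq_ofNat_of_zero_le ((ord_nonneg_iff hx0).2 hx)
  convert eval_mem_polynomialOver D (C (charAC ϖ χ x) * X ^ k) using 2 with t
  rw [quasiChar_apply, hk, zpow_natCast]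
  simp

variable {χ}

lemma integrableOn_quasiChar_comp
    (hχ : Continuous χ) {X : Type*} [MeasurableSpace X] (ν : Measure X) {S : Set X}
    (hS : MeasurableSet S) (hν : ν S < ⊤) {g : X → K} (hg : Measurable g)
    (hgS : ∀ x ∈ S, g x ∈ 𝒪[K]) (t : PuncturedDisc) :
    IntegrableOn (fun x => quasiChar hϖ χ t (g x)) S ν := by
  obtain ⟨B, hB⟩ := exists_norm_quasiChar_le hϖ χ hχ
  refine IntegrableOn.of_bound hν
    ((measurable_quasiChar hϖ χ hχ t).comp hg).aestronglyMeasurable B ?_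
  exact (ae_restrict_mem hS).mono fun x hx => hB t _ (hgS x hx)

lemma eventually_quasiChar_comp_eq
    (hχ : Continuous χ) {X : Type*} [TopologicalSpace X] {g : X → K} {x : X}
    (hg : ContinuousAt g x) (hx : g x ≠ 0) :
    ∀ᶠ y in 𝓝 x, (fun t => quasiChar hϖ χ t (g y)) = fun t => quasiChar hϖ χ t (g x) := by
  filter_upwards [hg.eventually (eventually_quasiChar_eq hϖ χ hχ hx)] with y hy
  exact funext hy

/-- The substitution `z ↦ ϖ z` on `ϖ 𝒪` reproduces the integral with factor `q⁻¹ t`, and the rest is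
an integral over units. -/
lemma setIntegral_quasiChar_mem
    (hχ : Continuous χ) (hμ : μ (𝒪[K] : Set K) = 1) :
    (fun t => ∫ z in (𝒪[K] : Set K), quasiChar hϖ χ t z ∂μ)
      ∈ polynomialOver (denomFactor (residueCard K) 1 1) := by
  have hψ := setIntegral_integers_diff_disc_mem μ hϖ (polynomialOver 1) 1
    (fun z t => quasiChar hϖ χ t z)
    (fun x _ hx0 => eventually_quasiChar_comp_eq hϖ hχ continuousAt_id hx0)
    fun x hx _ => quasiChar_mem_polynomialOver hϖ χ 1 hx
  rw [← one_mul (denomFactor _ _ _)]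
  refine mem_polynomialOver_of_self_similar hψ fun t => ?_
  have hinteg := integrableOn_quasiChar_comp hϖ hχ μ measurableSet_integers
    (by rw [hμ]; exact ENNReal.one_lt_top) measurable_id (fun x hx => hx) t
  have h1 := setIntegral_integers_eq_add μ hϖ hμ 1 hinteg
  simp only [pow_one, map_mul, quasiChar_uniformizer, integral_const_mul, id] at h1 ⊢
  rw [mul_assoc]
  exact h1

lemma setIntegral_disc_quasiChar_mem
    (hχ : Continuous χ) (hμ : μ (𝒪[K] : Set K) = 1) (a : K) {b : K} (hb : b ∈ 𝒪[K]) (e : ℕ) :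
    (fun t => ∫ x in disc a ((ϖ : K) ^ e), quasiChar hϖ χ t (b * (x - a)) ∂μ)
      ∈ polynomialOver (denomFactor (residueCard K) 1 1) := by
  obtain ⟨G, hG⟩ := quasiChar_mem_polynomialOver hϖ χ 1 hb
  convert eval_mul_mem_polynomialOver (setIntegral_quasiChar_mem μ hϖ hχ hμ)
    (C ((residueCard K : ℂ)⁻¹ ^ e) * G * X ^ e) using 2 with t
  rw [setIntegral_disc_pow μ hμ hϖ]
  simp only [add_sub_cancel_left, map_mul, map_pow, quasiChar_uniformizer, integral_const_mul,
    eval_mul, eval_C, eval_pow, eval_X, ← hG t, eval_one]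
  ring

end SingleVariable

/-! ### The zeta integral of `y ^ m - c` in `y` -/

section FiberZeta

open Filter Topology

variable {K : Type*} [Field K] [ValuativeRel K] [TopologicalSpace K]
  [IsNonarchimedeanLocalField K] [MeasurableSpace K] [BorelSpace K]
  (μ : Measure K) [μ.IsAddHaarMeasure] {ϖ : 𝒪[K]} (hϖ : Irreducible ϖ)
  (χ : (𝒪[K])ˣ →* ℂˣ) (m : ℕ)

/-- The zeta integral of `y ^ m - c` in the variable `y`. -/
noncomputable def fiberZeta (c : K) (t : PuncturedDisc) : ℂ :=
  ∫ y in (𝒪[K] : Set K), quasiChar hϖ χ t (y ^ m - c) ∂μ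

variable {χ m}

lemma stronglyMeasurable_fiberZeta (hχ : Continuous χ) (t : PuncturedDisc) :
    StronglyMeasurable fun c => fiberZeta μ hϖ χ m c t := by
  refine StronglyMeasurable.integral_prod_right'
    (f := fun z : K × K => quasiChar hϖ χ t (z.2 ^ m - z.1)) ?_
  refine Measurable.stronglyMeasurable ?_
  exact (measurable_quasiChar hϖ χ hχ t).comp (by fun_prop)

lemma exists_norm_fiberZeta_le
    (hχ : Continuous χ) (hμ : μ (𝒪[K] : Set K) = 1) :
    ∃ B : ℝ, ∀ t, ∀ c ∈ 𝒪[K], ‖fiberZeta μ hϖ χ m c t‖ ≤ B := by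
  obtain ⟨B, hB⟩ := exists_norm_quasiChar_le hϖ χ hχ
  refine ⟨B, fun t c hc => ?_⟩
  have := norm_setIntegral_le_of_norm_le_const (μ := μ) (s := (𝒪[K] : Set K))
    (f := fun y => quasiChar hϖ χ t (y ^ m - c)) (by rw [hμ]; exact ENNReal.one_lt_top)
    fun y hy => hB t _ (sub_mem (pow_mem hy m) hc)
  unfold fiberZeta
  simpa [Measure.real, hμ] using this

lemma integrableOn_fiberZeta_comp
    (hχ : Continuous χ) (hμ : μ (𝒪[K] : Set K) = 1) {g : K → K} (hg : Measurable g)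
    (hgO : ∀ x ∈ 𝒪[K], g x ∈ 𝒪[K])
    (t : PuncturedDisc) :
    IntegrableOn (fun x => fiberZeta μ hϖ χ m (g x) t) (𝒪[K] : Set K) μ := by
  obtain ⟨B, hB⟩ := exists_norm_fiberZeta_le μ hϖ hχ (m := m) hμ
  refine IntegrableOn.of_bound (by rw [hμ]; exact ENNReal.one_lt_top)
    ((stronglyMeasurable_fiberZeta μ hϖ hχ t).comp_measurable hg).aestronglyMeasurable B ?_
  exact (ae_restrict_mem measurableSet_integers).mono fun x hx => hB t _ (hgO x hx)

/-- As `m` is a unit and `c ≠ 0`, the roots of `y ^ m - c` are simple, so near each root the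
integrand is the quasi-character of a linear function. -/
lemma fiberZeta_mem_polynomialOver
    (hχ : Continuous χ) (hμ : μ (𝒪[K] : Set K) = 1) (hm0 : (m : K) ≠ 0) (hm : ord (m : K) = 0)
    {c : K}
    (hc : c ∈ 𝒪[K]) (hc0 : c ≠ 0) :
    fiberZeta μ hϖ χ m c ∈ polynomialOver (denomFactor (residueCard K) 1 1) := by
  classical
  have hmpos : m ≠ 0 := by
    rintro rfl
    simp at hm0
  have hP : ∀ y : K, y ∈ (X ^ m - C c).roots.toFinset ↔ y ^ m = c := by
    intro y
    rw [Multiset.mem_toFinset, mem_roots (X_pow_sub_C_ne_zero (Nat.pos_of_ne_zero hmpos) c)]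
    simp [IsRoot, sub_eq_zero]
  refine setIntegral_mem_of_locallyConstant_compl_finset μ hϖ
    (polynomialOver (denomFactor (residueCard K) 1 1))
    (fun y t => quasiChar hϖ χ t (y ^ m - c)) (X ^ m - C c).roots.toFinset isCompact_integers
    isOpen_integers (fun t => ?_) (fun y hy hyP => ?_) (fun y hy hyP => ?_) fun y hyP hy => ?_
  · exact integrableOn_quasiChar_comp hϖ hχ μ measurableSet_integers
      (by rw [hμ]; exact ENNReal.one_lt_top) (by fun_prop)
      (fun x hx => sub_mem (pow_mem hx m) hc) t
  · rw [hP, ← sub_eq_zero] at hyP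
    exact eventually_quasiChar_comp_eq hϖ hχ (g := fun y => y ^ m - c) (by fun_prop) hyP
  · exact quasiChar_mem_polynomialOver hϖ χ _ (sub_mem (pow_mem hy m) hc)
  · rw [hP] at hyP
    subst hyP
    have hy0 : y ≠ 0 := by
      rintro rfl
      exact hc0 (zero_pow hmpos)
    obtain ⟨N, hN, hNχ⟩ := exists_quasiChar_eq_one hϖ χ hχ
    obtain ⟨k, hk⟩ := Int.eq_ofNat_of_zero_le ((ord_nonneg_iff hy0).2 hy)
    -- With `k = ord y`, a disc of radius `ϖ ^ (N + k)` around `y` keeps `x / y` in `1 + ϖ ^ N 𝒪`;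
    -- there `x ^ m - y ^ m` is `m y ^ (m - 1) (x - y)` up to a factor on which the quasi-character
    -- is `1`.
    refine ⟨N + k, fun e he => ?_⟩
    have hmO := mem_integers_of_ord_eq_zero hm0 hm
    convert setIntegral_disc_quasiChar_mem μ hϖ hχ hμ y (mul_mem (pow_mem hy (m - 1)) hmO) e
      using 2 with t
    refine setIntegral_congr_fun
      (isOpen_disc y (pow_ne_zero e (uniformizer_ne_zero hϖ))).measurableSet fun x hx => ?_
    have hv : x / y ∈ disc 1 ((ϖ : K) ^ N) := by
      obtain ⟨z, hz, hzx⟩ := disc_anti y ϖ he hx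
      have h1 : (ϖ : K) ^ k / y ∈ 𝒪[K] := by
        rw [← ord_nonneg_iff (div_ne_zero (pow_ne_zero k (uniformizer_ne_zero hϖ)) hy0),
          ord_div (pow_ne_zero k (uniformizer_ne_zero hϖ)) hy0, ord_uniformizer_pow hϖ, hk,
            sub_self]
      refine ⟨_, mul_mem h1 hz, ?_⟩
      rw [← hzx]
      simp only [pow_add]
      field_simp
    obtain ⟨w, hw, hsum⟩ := geom_sum_of_mem_disc_one hm0 hm hv
    have h2 : x ^ m - y ^ m = y ^ (m - 1) * m * (x - y) * w := by
      have h3 := mul_geom_sum (x / y) m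
      rw [hsum, div_pow] at h3
      obtain ⟨l, rfl⟩ := Nat.exists_eq_succ_of_ne_zero hmpos
      simp only [Nat.succ_eq_add_one, Nat.add_sub_cancel, pow_succ y] at h3 ⊢
      field_simp at h3
      linear_combination -h3
    rw [h2, map_mul, hNχ t w hw, mul_one]

/-- Write `v = w ^ m` and substitute `y ↦ w y`: the measure is preserved because `w` is a unit, and
the factor `w ^ m = v` has quasi-character `1`. -/
lemma fiberZeta_mul_of_mem_disc_one
    (hμ : μ (𝒪[K] : Set K) = 1) {N : ℕ} (hN : 1 ≤ N)
    (hNχ : ∀ t, ∀ x ∈ disc (1 : K) ((ϖ : K) ^ N), quasiChar hϖ χ t x = 1) (hm0 : (m : K) ≠ 0)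
    (hm : ord (m : K) = 0) (c : K) {v : K} (hv : v ∈ disc 1 ((ϖ : K) ^ N)) :
    fiberZeta μ hϖ χ m (c * v) = fiberZeta μ hϖ χ m c := by
  obtain ⟨w, hw, rfl⟩ := exists_pow_eq_of_mem_disc_one hϖ hm0 hm hN hv
  obtain ⟨hw0, hword⟩ := ne_zero_and_ord_eq_zero_of_mem_disc_one hϖ hN hw
  ext t
  unfold fiberZeta
  rw [← setIntegral_unit_mul μ hμ (mem_integers_of_ord_eq_zero hw0 hword)
    (inv_mem_integers_of_ord_eq_zero hw0 hword) hw0]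
  congr 1
  ext y
  rw [show (w * y) ^ m - c * w ^ m = w ^ m * (y ^ m - c) by ring, map_mul, hNχ t _ hv, one_mul]

lemma eventually_fiberZeta_comp_eq
    (hχ : Continuous χ) (hμ : μ (𝒪[K] : Set K) = 1) {X : Type*} [TopologicalSpace X]
    (hm0 : (m : K) ≠ 0)
    (hm : ord (m : K) = 0) {g : X → K} {x : X} (hg : ContinuousAt g x) (hx : g x ≠ 0) :
    ∀ᶠ y in 𝓝 x, fiberZeta μ hϖ χ m (g y) = fiberZeta μ hϖ χ m (g x) := by
  obtain ⟨N, hN, hNχ⟩ := exists_quasiChar_eq_one hϖ χ hχ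
  filter_upwards [hg.eventually (eventually_mul_mem_disc_one hϖ hx N)]
  rintro y ⟨v, hv, h⟩
  rw [h, fiberZeta_mul_of_mem_disc_one μ hϖ hμ hN hNχ hm0 hm _ hv]

/-- For a unit `y`, `y ^ m - ϖ ^ m c` is `y ^ m` times an element of `1 + ϖ ^ N 𝒪`, so the units
contribute a constant free of `c` and `t`. On `ϖ 𝒪`, substituting `ϖ y` for `y` pulls out `ϖ ^ m`.
-/
lemma exists_fiberZeta_pow_mul
    (hχ : Continuous χ) (hμ : μ (𝒪[K] : Set K) = 1) {N : ℕ}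
    (hNχ : ∀ t, ∀ x ∈ disc (1 : K) ((ϖ : K) ^ N), quasiChar hϖ χ t x = 1) :
    ∃ A : ℂ, ∀ c ∈ disc 0 ((ϖ : K) ^ N), ∀ t, fiberZeta μ hϖ χ m ((ϖ : K) ^ m * c) t
      = A + (residueCard K : ℂ)⁻¹ * (t : ℂ) ^ m * fiberZeta μ hϖ χ m c t := by
  refine ⟨∫ y in (𝒪[K] : Set K) \ disc 0 ((ϖ : K) ^ 1), charAC ϖ χ y ^ m ∂μ, fun c hc t => ?_⟩
  have hcO : c ∈ 𝒪[K] := disc_subset_integers (zero_mem _) (pow_mem ϖ.2 N) hc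
  have hinteg := integrableOn_quasiChar_comp hϖ hχ μ measurableSet_integers
    (g := fun y => y ^ m - (ϖ : K) ^ m * c) (by rw [hμ]; exact ENNReal.one_lt_top) (by fun_prop)
    (fun x hx => sub_mem (pow_mem hx m) (mul_mem (pow_mem ϖ.2 m) hcO)) t
  unfold fiberZeta
  rw [setIntegral_integers_eq_add μ hϖ hμ 1 hinteg, pow_one (_⁻¹)]
  have hmeas : MeasurableSet ((𝒪[K] : Set K) \ disc 0 ((ϖ : K) ^ 1)) :=
    measurableSet_integers.diff
      (isOpen_disc 0 (pow_ne_zero 1 (uniformizer_ne_zero hϖ))).measurableSet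
  congr 1
  · refine setIntegral_congr_fun hmeas fun y hy => ?_
    have hy0 : y ≠ 0 := by
      rintro rfl
      exact hy.2 (self_mem_disc _ _)
    have hord : ord y = 0 := by
      have h1 := (ord_nonneg_iff hy0).2 hy.1
      have h2 := mt (mem_disc_zero_iff_ord hϖ hy0 1).2 hy.2
      push_cast at h2
      omega
    obtain ⟨z, hz, rfl⟩ := hc
    have hv : 1 - (ϖ : K) ^ m * ((0 + (ϖ : K) ^ N * z)) / y ^ m ∈ disc 1 ((ϖ : K) ^ N) := by
      refine ⟨-((ϖ : K) ^ m * z * (y⁻¹) ^ m), neg_mem (mul_mem (mul_mem (pow_mem ϖ.2 m) hz)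
        (pow_mem (inv_mem_integers_of_ord_eq_zero hy0 hord) m)), ?_⟩
      simp only [inv_pow]
      field_simp
      ring
    have h3 : y ^ m - (ϖ : K) ^ m * ((0 + (ϖ : K) ^ N * z))
        = y ^ m * (1 - (ϖ : K) ^ m * ((0 + (ϖ : K) ^ N * z)) / y ^ m) := by
      field_simp
    simp only
    rw [h3, map_mul, hNχ t _ hv, mul_one, map_pow, quasiChar_of_ord_eq_zero hϖ χ t hord]
  · rw [mul_assoc, ← integral_const_mul ((t : ℂ) ^ m)]
    congr 1
    refine integral_congr_ae (.of_forall fun y => ?_)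
    simp only
    rw [show ((ϖ : K) ^ 1 * y) ^ m - (ϖ : K) ^ m * c = (ϖ : K) ^ m * (y ^ m - c) by ring, map_mul,
      map_pow, quasiChar_uniformizer]

lemma exists_fiberZeta_pow_pow_mul
    (hχ : Continuous χ) (hμ : μ (𝒪[K] : Set K) = 1) {N : ℕ}
    (hNχ : ∀ t, ∀ x ∈ disc (1 : K) ((ϖ : K) ^ N), quasiChar hϖ χ t x = 1) (j : ℕ) :
    ∃ P : ℂ[X], ∀ c ∈ disc 0 ((ϖ : K) ^ N), ∀ t : PuncturedDisc,
      fiberZeta μ hϖ χ m ((ϖ : K) ^ (m * j) * c) t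
        = P.eval (t : ℂ) + (residueCard K : ℂ)⁻¹ ^ j * (t : ℂ) ^ (m * j)
          * fiberZeta μ hϖ χ m c t := by
  obtain ⟨A, hA⟩ := exists_fiberZeta_pow_mul μ hϖ hχ hμ (m := m) hNχ
  induction j with
  | zero => exact ⟨0, fun c _ t => by simp⟩
  | succ j ih =>
    obtain ⟨P, hP⟩ := ih
    refine ⟨C A + C (residueCard K : ℂ)⁻¹ * X ^ m * P, fun c hc t => ?_⟩
    have hc' : (ϖ : K) ^ (m * j) * c ∈ disc 0 ((ϖ : K) ^ N) := by
      obtain ⟨z, hz, rfl⟩ := hc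
      exact ⟨(ϖ : K) ^ (m * j) * z, mul_mem (pow_mem ϖ.2 _) hz, by simp only; ring⟩
    rw [mul_add_one, pow_add, mul_comm ((ϖ : K) ^ (m * j)), mul_assoc, hA _ hc', hP c hc]
    simp only [eval_add, eval_mul, eval_C, eval_pow, eval_X]
    ring

end FiberZeta

/-! ### The outer integral and the contribution of each root -/

section PlaneZeta

open Filter Topology

variable {K : Type*} [Field K] [ValuativeRel K] [TopologicalSpace K]
  [IsNonarchimedeanLocalField K] [MeasurableSpace K] [BorelSpace K]
  (μ : Measure K) [μ.IsAddHaarMeasure] {ϖ : 𝒪[K]} (hϖ : Irreducible ϖ)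
  {χ : (𝒪[K])ˣ →* ℂˣ} {m : ℕ}

lemma integrableOn_integerSquare_quasiChar_comp
    (hχ : Continuous χ) (hμ : μ (𝒪[K] : Set K) = 1) {g : K × K → K} (hg : Measurable g)
    (hgO : ∀ z ∈ integerSquare K, g z ∈ 𝒪[K]) (t : PuncturedDisc) :
    IntegrableOn (fun z => quasiChar hϖ χ t (g z)) (integerSquare K) (μ.prod μ) := by
  refine integrableOn_quasiChar_comp hϖ hχ (μ.prod μ)
    (measurableSet_integers.prod measurableSet_integers) ?_ hg hgO t
  rw [Measure.prod_prod, hμ, one_mul]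
  exact ENNReal.one_lt_top

/-- The substitution `z ↦ ϖ ^ a z` multiplies `β z ^ n` by `ϖ ^ (a n) = ϖ ^ (m b)`, which `b` steps
of the recursion for `fiberZeta` undo. The factor `q ^ (-a)` is the measure of `ϖ ^ a 𝒪`, and `q ^
(-b)` comes from the recursion. -/
lemma setIntegral_fiberZeta_pow_mem
    (hχ : Continuous χ) (hμ : μ (𝒪[K] : Set K) = 1) {N : ℕ}
    (hNχ : ∀ t, ∀ x ∈ disc (1 : K) ((ϖ : K) ^ N), quasiChar hϖ χ t x = 1) (hm0 : (m : K) ≠ 0)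
    (hm : ord (m : K) = 0) (n : ℕ) {β : K} (hβ : β ∈ disc 0 ((ϖ : K) ^ N)) (hβ0 : β ≠ 0) :
    (fun t => ∫ z in (𝒪[K] : Set K), fiberZeta μ hϖ χ m (β * z ^ n) t ∂μ)
      ∈ polynomialOver (denomFactor (residueCard K) 1 1 *
        denomFactor (residueCard K) (n / n.gcd m + m / n.gcd m)
          (n / n.gcd m * (m / n.gcd m) * n.gcd m)) := by
  set a := m / n.gcd m with ha
  set b := n / n.gcd m with hb
  have hma : a * n.gcd m = m := Nat.div_mul_cancel (Nat.gcd_dvd_right n m)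
  have hnb : b * n.gcd m = n := Nat.div_mul_cancel (Nat.gcd_dvd_left n m)
  have hexp : b * a * n.gcd m = m * b := by rw [mul_assoc, hma, mul_comm]
  -- Dividing by the gcd makes this the smallest common multiple of `n` and `m`, hence the smallest
  -- period available.
  have hexp' : a * n = m * b := by
    rw [← hexp]; conv_lhs => rw [← hnb]
    ring
  have hβO : β ∈ 𝒪[K] := disc_subset_integers (zero_mem _) (pow_mem ϖ.2 N) hβ
  have hgO : ∀ z ∈ 𝒪[K], β * z ^ n ∈ 𝒪[K] := fun z hz => mul_mem hβO (pow_mem hz n)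
  obtain ⟨P, hP⟩ := exists_fiberZeta_pow_pow_mul μ hϖ hχ hμ (m := m) hNχ b
  have hψ₁ := setIntegral_integers_diff_disc_mem μ hϖ
    (polynomialOver (denomFactor (residueCard K) 1 1)) a
    (fun z => fiberZeta μ hϖ χ m (β * z ^ n))
    (fun z _ hz0 => eventually_fiberZeta_comp_eq μ hϖ hχ hμ hm0 hm (g := fun z => β * z ^ n)
      (by fun_prop) (mul_ne_zero hβ0 (pow_ne_zero n hz0)))
    fun z hz hz0 => fiberZeta_mem_polynomialOver μ hϖ hχ hμ hm0 hm (hgO z hz)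
      (mul_ne_zero hβ0 (pow_ne_zero n hz0))
  have hψ₂ := eval_mem_polynomialOver (denomFactor (residueCard K) 1 1)
    (C ((residueCard K : ℂ)⁻¹ ^ a) * P)
  refine mem_polynomialOver_of_self_similar (Submodule.add_mem _ hψ₁ hψ₂) fun t => ?_
  have hinteg := integrableOn_fiberZeta_comp μ hϖ hχ hμ (m := m) (g := fun z => β * z ^ n)
    (by fun_prop) hgO t
  have hsplit := setIntegral_integers_eq_add μ hϖ hμ a hinteg
  have hstep : ∀ z ∈ (𝒪[K] : Set K), fiberZeta μ hϖ χ m (β * ((ϖ : K) ^ a * z) ^ n) t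
      = P.eval (t : ℂ) + (residueCard K : ℂ)⁻¹ ^ b * (t : ℂ) ^ (m * b)
        * fiberZeta μ hϖ χ m (β * z ^ n) t := by
    intro z hz
    rw [← hP, mul_pow, ← pow_mul, hexp']
    · congr 1
      ring
    · obtain ⟨w, hw, rfl⟩ := hβ
      exact ⟨w * z ^ n, mul_mem hw (pow_mem hz n), by simp only; ring⟩
  have hconst : IntegrableOn (fun _ : K => P.eval (t : ℂ)) (𝒪[K] : Set K) μ :=
    integrableOn_const (by rw [hμ]; exact ENNReal.one_ne_top)
  rw [setIntegral_congr_fun measurableSet_integers hstep, integral_add hconst (hinteg.const_mul _),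
    integral_const_mul, setIntegral_const, Measure.real, hμ, ENNReal.toReal_one, one_smul]
    at hsplit
  rw [Pi.add_apply, eval_mul, eval_C, hexp]
  linear_combination hsplit

/-- Either `y ^ m = β r` with `r` integral, and translating by `r` leaves the quasi-character of `-β
z`, or the argument never vanishes on the integers and the integrand is locally constant. -/
lemma setIntegral_quasiChar_pow_sub_mul_mem
    (hχ : Continuous χ) (hμ : μ (𝒪[K] : Set K) = 1) {β y : K} (hβ : β ∈ 𝒪[K])
    (hy : y ∈ 𝒪[K]) :
    (fun t => ∫ z in (𝒪[K] : Set K), quasiChar hϖ χ t (y ^ m - β * z) ∂μ)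
      ∈ polynomialOver (denomFactor (residueCard K) 1 1) := by
  by_cases h : y ^ m ∈ disc 0 β
  · obtain ⟨r, hr, h⟩ := h
    have h1 := setIntegral_disc_quasiChar_mem μ hϖ hχ hμ 0 (neg_mem hβ) 0
    rw [pow_zero, disc_zero_one] at h1
    convert h1 using 2 with t
    rw [← setIntegral_add_left μ hr]
    refine integral_congr_ae (.of_forall fun z => ?_)
    simp only [← h]
    congr 1
    ring
  · have hne : ∀ z ∈ 𝒪[K], y ^ m - β * z ≠ 0 := fun z hz h0 =>
      h ⟨z, hz, by simp only; linear_combination -h0⟩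
    exact setIntegral_mem_of_locallyConstant μ _ isCompact_integers measurableSet_integers
      (fun z t => quasiChar hϖ χ t (y ^ m - β * z))
      (fun z hz => (eventually_quasiChar_comp_eq hϖ hχ (g := fun z => y ^ m - β * z) (by fun_prop)
        (hne z hz)).filter_mono nhdsWithin_le_nhds)
      fun z hz => quasiChar_mem_polynomialOver hϖ χ _ (sub_mem (pow_mem hy m) (mul_mem hβ hz))

/-- A simple root of `f` gives a smooth curve germ, so no factor beyond `1 - q⁻¹ t` should occur.
Exchanging the integrals makes this visible, since the argument is affine in `z`. -/
lemma setIntegral_fiberZeta_mul_mem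
    (hχ : Continuous χ) (hμ : μ (𝒪[K] : Set K) = 1) {β : K} (hβ : β ∈ 𝒪[K]) (hβ0 : β ≠ 0) :
    (fun t => ∫ z in (𝒪[K] : Set K), fiberZeta μ hϖ χ m (β * z) t ∂μ)
      ∈ polynomialOver (denomFactor (residueCard K) 1 1) := by
  have hswap : (fun t => ∫ z in (𝒪[K] : Set K), fiberZeta μ hϖ χ m (β * z) t ∂μ)
      = fun t => ∫ y in (𝒪[K] : Set K), ∫ z in (𝒪[K] : Set K),
        quasiChar hϖ χ t (y ^ m - β * z) ∂μ ∂μ := by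
    ext t
    refine integral_integral_swap (f := fun z y => quasiChar hϖ χ t (y ^ m - β * z)) ?_
    rw [Measure.prod_restrict]
    exact integrableOn_integerSquare_quasiChar_comp μ hϖ hχ hμ
      (g := fun z => z.2 ^ m - β * z.1) (by fun_prop)
      (fun z hz => sub_mem (pow_mem hz.2 m) (mul_mem hβ hz.1)) t
  rw [hswap]
  refine setIntegral_mem_of_locallyConstant μ _ isCompact_integers measurableSet_integers
    (fun y t => ∫ z in (𝒪[K] : Set K), quasiChar hϖ χ t (y ^ m - β * z) ∂μ) (fun y hy => ?_)
    fun y hy => setIntegral_quasiChar_pow_sub_mul_mem μ hϖ hχ hμ hβ hy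
  refine Eventually.filter_mono nhdsWithin_le_nhds ?_
  filter_upwards [disc_mem_nhds y hβ0]
  rintro _ ⟨w, hw, rfl⟩
  ext t
  -- Moving `y` by a multiple of `β` moves `y ^ m` by some `β r`, which the translation `z ↦ r + z`
  -- absorbs; so the inner integral is locally constant in `y`.
  obtain ⟨r, hr⟩ : (⟨β, hβ⟩ : 𝒪[K]) ∣ (⟨y, hy⟩ + ⟨β, hβ⟩ * ⟨w, hw⟩) ^ m - ⟨y, hy⟩ ^ m :=
    (Dvd.intro ⟨w, hw⟩ (by ring)).trans (sub_dvd_pow_sub_pow _ _ m)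
  have hr' : (y + β * w) ^ m - y ^ m = β * r := by
    simpa using congrArg Subtype.val hr
  simp only
  rw [← setIntegral_add_left μ r.2]
  refine integral_congr_ae (.of_forall fun z => ?_)
  simp only
  congr 1
  linear_combination hr'

variable {k : ℕ} {γ₀ : K} {γ : Fin k → K} {n : Fin k → ℕ}

-- Off the roots the integrand is locally constant. Near a root `γ i` the cofactor `U` of `(x - γ i)
-- ^ n i` is `U (γ i)` times an element of `1 + ϖ ^ N 𝒪`, invisible to `fiberZeta`, so the integral
-- there is that of a monomial.
open Classical in
lemma setIntegral_fiberZeta_comp_mem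
    (hχ : Continuous χ) (hμ : μ (𝒪[K] : Set K) = 1) (hγ₀ : γ₀ ≠ 0) (hγ : Function.Injective γ)
    (hn : ∀ i, 1 ≤ n i) (hm0 : (m : K) ≠ 0) (hm : ord (m : K) = 0) {F : K → K}
    (hF : ∀ x, F x = γ₀ * ∏ i, (x - γ i) ^ n i) (hFO : ∀ x ∈ 𝒪[K], F x ∈ 𝒪[K]) :
    (fun t => ∫ x in (𝒪[K] : Set K), fiberZeta μ hϖ χ m (F x) t ∂μ)
      ∈ polynomialOver (denomFactor (residueCard K) 1 1 *
        ∏ i ∈ Finset.univ.filter (fun i => γ i ∈ 𝒪[K]) with 2 ≤ n i,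
          denomFactor (residueCard K) (n i / (n i).gcd m + m / (n i).gcd m)
            (n i / (n i).gcd m * (m / (n i).gcd m) * (n i).gcd m)) := by
  have hFc : Continuous F := by
    rw [show F = fun x => γ₀ * ∏ i, (x - γ i) ^ n i from funext hF]
    fun_prop
  have hF0 : ∀ x, x ∉ Finset.univ.image γ → F x ≠ 0 := by
    intro x hx
    rw [hF]
    refine mul_ne_zero hγ₀ (Finset.prod_ne_zero_iff.2 fun i _ => pow_ne_zero _ ?_)
    rw [sub_ne_zero]
    rintro rfl
    exact hx (Finset.mem_image_of_mem γ (Finset.mem_univ i))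
  refine setIntegral_mem_of_locallyConstant_compl_finset μ hϖ _ (fun x => fiberZeta μ hϖ χ m (F x))
    (Finset.univ.image γ) isCompact_integers isOpen_integers
    (integrableOn_fiberZeta_comp μ hϖ hχ hμ hFc.measurable hFO)
    (fun x _ hxP => eventually_fiberZeta_comp_eq μ hϖ hχ hμ hm0 hm hFc.continuousAt (hF0 x hxP))
    (fun x hx hxP => polynomialOver_mono (dvd_mul_right _ _)
      (fiberZeta_mem_polynomialOver μ hϖ hχ hμ hm0 hm (hFO x hx) (hF0 x hxP))) ?_
  intro x hx hxO
  obtain ⟨i, -, rfl⟩ := Finset.mem_image.1 hx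
  obtain ⟨N, hN, hNχ⟩ := exists_quasiChar_eq_one hϖ χ hχ
  set U : K → K := fun x => γ₀ * ∏ j ∈ Finset.univ.erase i, (x - γ j) ^ n j with hU
  have hUc : Continuous U := by fun_prop
  have hu0 : U (γ i) ≠ 0 := by
    refine mul_ne_zero hγ₀ (Finset.prod_ne_zero_iff.2 fun j hj => pow_ne_zero _ ?_)
    rw [sub_ne_zero]
    exact fun h => Finset.ne_of_mem_erase hj (hγ h).symm
  have hFU : ∀ x, F x = U x * (x - γ i) ^ n i := by
    intro x
    rw [hF, hU, ← Finset.mul_prod_erase _ _ (Finset.mem_univ i)]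
    ring
  obtain ⟨e₁, he₁⟩ := exists_disc_subset hϖ
    (hUc.continuousAt.eventually (eventually_mul_mem_disc_one hϖ hu0 N))
  -- The first bound freezes `U` up to `1 + ϖ ^ N 𝒪`. The second compensates a possibly negative
  -- order of `U (γ i)`, so that `β` lies in `ϖ ^ N 𝒪`; it uses `e ≤ n i * e`.
  refine ⟨max e₁ (N + (-ord (U (γ i))).toNat), fun e he => ?_⟩
  have hϖe := pow_ne_zero e (uniformizer_ne_zero hϖ)
  set β := U (γ i) * ((ϖ : K) ^ e) ^ n i with hβdef
  have hβ0 : β ≠ 0 := mul_ne_zero hu0 (pow_ne_zero _ hϖe)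
  have hβ : β ∈ disc 0 ((ϖ : K) ^ N) := by
    rw [mem_disc_zero_iff_ord hϖ hβ0, hβdef, ord_mul hu0 (pow_ne_zero _ hϖe), ord_pow,
      ord_uniformizer_pow hϖ]
    have h1 := Int.self_le_toNat (-ord (U (γ i)))
    have h2 : N + (-ord (U (γ i))).toNat ≤ e := (le_max_right _ _).trans he
    have h3 : e ≤ n i * e := Nat.le_mul_of_pos_left e (hn i)
    zify at h2 h3
    linarith
  have hlocal : (fun t => ∫ x in disc (γ i) ((ϖ : K) ^ e), fiberZeta μ hϖ χ m (F x) t ∂μ)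
      = (residueCard K : ℂ)⁻¹ ^ e •
        fun t => ∫ z in (𝒪[K] : Set K), fiberZeta μ hϖ χ m (β * z ^ n i) t ∂μ := by
    ext t
    rw [setIntegral_disc_pow μ hμ hϖ, Pi.smul_apply, smul_eq_mul]
    congr 1
    refine setIntegral_congr_fun measurableSet_integers fun z hz => ?_
    obtain ⟨v, hv, hUv⟩ := he₁ e ((le_max_left _ _).trans he) ⟨z, hz, rfl⟩
    simp only at hUv ⊢
    rw [hFU, hUv, show U (γ i) * v * (γ i + (ϖ : K) ^ e * z - γ i) ^ n i = β * z ^ n i * v by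
        rw [hβdef]; ring,
      fiberZeta_mul_of_mem_disc_one μ hϖ hμ hN hNχ hm0 hm _ hv]
  rw [hlocal]
  refine Submodule.smul_mem _ _ ?_
  rcases (hn i).eq_or_lt with hi | hi
  · rw [← hi]
    simp only [pow_one]
    exact polynomialOver_mono (dvd_mul_right _ _) (setIntegral_fiberZeta_mul_mem μ hϖ hχ hμ
      (disc_subset_integers (zero_mem _) (pow_mem ϖ.2 N) hβ) hβ0)
  · refine polynomialOver_mono (mul_dvd_mul_left _ ?_)
      (setIntegral_fiberZeta_pow_mem μ hϖ hχ hμ hNχ hm0 hm (n i) hβ hβ0)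
    exact Finset.dvd_prod_of_mem (fun i => denomFactor (residueCard K)
      (n i / (n i).gcd m + m / (n i).gcd m) (n i / (n i).gcd m * (m / (n i).gcd m) * (n i).gcd m))
      (Finset.mem_filter.2 ⟨Finset.mem_filter.2 ⟨Finset.mem_univ i, hxO⟩, hi⟩)

end PlaneZeta

/-! ### From `t` back to `s` -/

section RationalValue

lemma cpow_eq_one_iff {q : ℕ} (hq : 2 ≤ q) {z : ℂ} (h : (q : ℂ) ^ z = 1) :
    ∃ l : ℤ, z = 2 * Real.pi * Complex.I * l / Real.log q := by
  have hq0 : (q : ℂ) ≠ 0 := by norm_cast; omega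
  have hlog : (Real.log q : ℂ) ≠ 0 := by
    rw [Complex.ofReal_ne_zero]
    exact (Real.log_pos (by exact_mod_cast hq)).ne'
  rw [Complex.cpow_def_of_ne_zero hq0, Complex.exp_eq_one_iff] at h
  obtain ⟨l, hl⟩ := h
  rw [← Complex.natCast_log] at hl
  refine ⟨l, ?_⟩
  rw [eq_div_iff hlog]
  linear_combination hl

lemma one_sub_cpow_eq_eval_denomFactor {q : ℕ} (hq : 2 ≤ q) (a b : ℕ) (s : ℂ) :
    1 - (q : ℂ) ^ (-(a : ℂ) - (b : ℂ) * s) = (denomFactor q a b).eval ((q : ℂ) ^ (-s)) := by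
  have hq0 : (q : ℂ) ≠ 0 := by norm_cast; omega
  rw [eval_denomFactor, sub_eq_add_neg (-(a : ℂ)), Complex.cpow_add _ _ hq0, Complex.cpow_neg,
    Complex.cpow_natCast, inv_pow, ← mul_neg, Complex.cpow_nat_mul]

lemma rootFactor_eq_eval_denomFactor {q : ℕ} (hq : 2 ≤ q) (m n : ℕ) (s : ℂ) :
    rootFactor q m n s = (denomFactor q (n / n.gcd m + m / n.gcd m)
      (n / n.gcd m * (m / n.gcd m) * n.gcd m)).eval ((q : ℂ) ^ (-s)) := by
  rw [← one_sub_cpow_eq_eval_denomFactor hq, rootFactor]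
  push_cast
  congr 2
  ring

lemma eval_denomFactor_ne_zero {q : ℕ} (hq : 2 ≤ q) {a : ℕ} (ha : a ≠ 0) (b : ℕ)
    (t : PuncturedDisc) : (denomFactor q a b).eval (t : ℂ) ≠ 0 := by
  rw [eval_denomFactor, sub_ne_zero]
  intro h
  have h1 := congrArg norm h
  rw [norm_one, norm_mul, norm_pow, norm_pow, norm_inv, Complex.norm_natCast] at h1
  have h2 : ((q : ℝ)⁻¹) ^ a < 1 :=
    pow_lt_one₀ (by positivity) (inv_lt_one_of_one_lt₀ (by exact_mod_cast hq)) ha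
  have h3 : ‖(t : ℂ)‖ ^ b ≤ 1 := pow_le_one₀ (norm_nonneg _) t.2.2.le
  have h4 : (0 : ℝ) ≤ (q : ℝ)⁻¹ ^ a := by positivity
  nlinarith

variable {K : Type*} [Field K] [ValuativeRel K] [TopologicalSpace K]
  [IsNonarchimedeanLocalField K]

lemma two_le_residueCard : 2 ≤ residueCard K := Finite.one_lt_card

/-- The point `q ^ (-s)` of the punctured unit disc, for `Re s > 0`. -/
noncomputable def negCpow {q : ℕ} (hq : 2 ≤ q) {s : ℂ} (hs : 0 < s.re) : PuncturedDisc :=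
  ⟨(q : ℂ) ^ (-s), by
    have hq0 : (q : ℂ) ≠ 0 := by norm_cast; omega
    exact (Complex.cpow_ne_zero_iff_of_exponent_ne_zero
      (neg_ne_zero.2 fun h => by simp [h] at hs)).2 hq0, by
    rw [Complex.norm_natCast_cpow_of_pos (by omega)]
    exact Real.rpow_lt_one_of_one_lt_of_neg (by exact_mod_cast hq) (by simpa using hs)⟩

lemma zetaIntegrand_eq_quasiChar {ϖ : 𝒪[K]} (hϖ : Irreducible ϖ) (χ : (𝒪[K])ˣ →* ℂˣ)
    (g : K × K → K) {s : ℂ} (hs : 0 < s.re) :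
    zetaIntegrand ϖ χ g s
      = fun z => quasiChar hϖ χ (negCpow (two_le_residueCard (K := K)) hs) (g z) := by
  ext z
  rw [zetaIntegrand, quasiChar_apply]
  rcases eq_or_ne (g z) 0 with h | h
  · rw [h, charAC_zero ϖ hϖ, zero_mul, zero_mul]
  congr 1
  have hq0 : (residueCard K : ℝ) ≠ 0 := by
    have := two_le_residueCard (K := K)
    positivity
  have hq0' : (residueCard K : ℂ) ≠ 0 := by exact_mod_cast hq0
  have hpow : (((residueCard K : ℝ) ^ (-ord (g z)) : ℝ) : ℂ) ≠ 0 := by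
    rw [Complex.ofReal_ne_zero]
    exact zpow_ne_zero _ hq0
  have hnn : (0 : ℝ) ≤ (residueCard K : ℝ) ^ (-ord (g z)) := by positivity
  rw [absVal, if_neg h, Complex.cpow_def_of_ne_zero hpow, ← Complex.ofReal_log hnn, Real.log_zpow]
  change _ = ((residueCard K : ℂ) ^ (-s)) ^ ord (g z)
  rw [Complex.cpow_def_of_ne_zero hq0', ← Complex.exp_int_mul, ← Complex.natCast_log]
  congr 1
  push_cast
  ring

/-- An inverse of `m` modulo `p` is a natural number `a` with `m * a = 1` in `K`; both orders are
nonnegative and sum to `0`. -/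
lemma ord_natCast_eq_zero (p : ℕ) (hp : p.Prime) [CharP K p] {m : ℕ} (hpm : ¬ p ∣ m) :
    (m : K) ≠ 0 ∧ ord (m : K) = 0 := by
  have hm0 : (m : K) ≠ 0 := mt (CharP.cast_eq_zero_iff K p m).1 hpm
  refine ⟨hm0, ?_⟩
  obtain ⟨a, -, ha⟩ := Nat.exists_mul_mod_eq_one_of_coprime
    ((hp.coprime_iff_not_dvd.2 hpm).symm) hp.one_lt
  have hma : (m : K) * a = 1 := by
    have h := congrArg (Nat.cast (R := K)) (Nat.div_add_mod (m * a) p)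
    rw [ha] at h
    simpa using h.symm
  have ha0 : (a : K) ≠ 0 := right_ne_zero_of_mul_eq_one hma
  have h1 := (ord_nonneg_iff hm0).2 (natCast_mem 𝒪[K] m)
  have h2 := (ord_nonneg_iff ha0).2 (natCast_mem 𝒪[K] a)
  have h3 := ord_mul hm0 ha0
  rw [hma, ord_one] at h3
  omega

end RationalValue

end LocalZeta

/-! ### The theorem -/

open Classical in
theorem theorem1p2
    {K : Type*} [Field K] [ValuativeRel K] [TopologicalSpace K] [IsNonarchimedeanLocalField K]
    [MeasurableSpace K] [BorelSpace K]
    (p : ℕ) (hp : p.Prime) [CharP K p]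
    -- the Haar measure on `K` for which the ring of integers has measure one
    (μ : Measure K) [μ.IsAddHaarMeasure] (hμ : μ (𝒪[K] : Set K) = 1)
    -- a uniformizer and a (continuous) multiplicative character of the unit group
    (ϖ : 𝒪[K]) (hϖ : Irreducible ϖ)
    (χ : (𝒪[K])ˣ →* ℂˣ) (hχ : Continuous χ)
    (m : ℕ) (hm : 2 ≤ m) (hpm : ¬ p ∣ m)
    -- `f` has integral coefficients and factors as `γ₀ ∏ (X - γ i) ^ n i` over `K`
    (f : (𝒪[K])[X]) (k : ℕ) (γ₀ : K) (hγ₀ : γ₀ ≠ 0)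
    (γ : Fin k → K) (hγ : Function.Injective γ) (n : Fin k → ℕ) (hn : ∀ i, 1 ≤ n i)
    (hf : f.map (algebraMap 𝒪[K] K) = C γ₀ * ∏ i, (X - C (γ i)) ^ n i) :
    let q : ℕ := LocalZeta.residueCard K
    let g : K × K → K := fun z => z.2 ^ m - aeval z.1 f
    let T : Finset (Fin k) := Finset.univ.filter fun i => γ i ∈ 𝒪[K]
    ∃ G : ℂ[X],
      let R : ℂ → ℂ := fun s => G.eval ((q : ℂ) ^ (-s)) /
        ((1 - (q : ℂ) ^ (-1 - s)) * ∏ i ∈ T with 2 ≤ n i, LocalZeta.rootFactor q m (n i) s)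
      -- the defining integral converges for `Re s > 0` and has the stated rational value
      (∀ s : ℂ, 0 < s.re →
        IntegrableOn (LocalZeta.zetaIntegrand ϖ χ g s) (LocalZeta.integerSquare K) (μ.prod μ) ∧
        LocalZeta.igusaZeta μ ϖ χ g s = R s) ∧
      -- so it continues meromorphically to `ℂ`, with poles only in the following list
      (∀ s : ℂ, MeromorphicAt R s) ∧
      ∀ s : ℂ, meromorphicOrderAt R s < 0 →
        (∃ l : ℤ, s = -1 + 2 * Real.pi * Complex.I * l / Real.log q) ∨
        ∃ i ∈ T, 2 ≤ n i ∧ ∃ l : ℤ,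
          s = (-(((n i / (n i).gcd m : ℕ) : ℂ) + ((m / (n i).gcd m : ℕ) : ℂ))
              + 2 * Real.pi * Complex.I * l / Real.log q) /
            (((n i / (n i).gcd m : ℕ) : ℂ) * ((m / (n i).gcd m : ℕ) : ℂ)
              * (((n i).gcd m : ℕ) : ℂ)) := by
  classical
  intro q g T
  have hq : 2 ≤ q := LocalZeta.two_le_residueCard (K := K)
  have hq0 : (q : ℂ) ≠ 0 := by norm_cast; omega
  obtain ⟨hm0, hmord⟩ := LocalZeta.ord_natCast_eq_zero (K := K) p hp hpm
  have hF : ∀ x : K, aeval x f = γ₀ * ∏ i, (x - γ i) ^ n i := by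
    intro x
    rw [← eval_map_algebraMap, hf]
    simp [eval_prod]
  have hFO : ∀ x ∈ 𝒪[K], aeval x f ∈ 𝒪[K] := by
    intro x hx
    have h : aeval x f = ((f.eval ⟨x, hx⟩ : 𝒪[K]) : K) :=
      aeval_algebraMap_apply_eq_algebraMap_eval (A := K) (⟨x, hx⟩ : 𝒪[K]) f
    rw [h]
    exact (f.eval ⟨x, hx⟩).2
  have hFc : Continuous fun x : K => aeval x f := by
    rw [funext hF]
    fun_prop
  have hgO : ∀ z ∈ LocalZeta.integerSquare K, g z ∈ 𝒪[K] := fun z hz =>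
    sub_mem (pow_mem hz.2 m) (hFO z.1 hz.1)
  have hgc : Continuous g := by
    have : Continuous fun z : K × K => aeval z.1 f := hFc.comp continuous_fst
    exact (continuous_snd.pow m).sub this
  have hinteg := LocalZeta.integrableOn_integerSquare_quasiChar_comp μ hϖ hχ hμ hgc.measurable hgO
  obtain ⟨G, hG⟩ := LocalZeta.setIntegral_fiberZeta_comp_mem μ hϖ hχ hμ hγ₀ hγ hn hm0 hmord hF hFO
  have hden : ∀ s : ℂ, (1 - (q : ℂ) ^ (-1 - s)) *
        ∏ i ∈ T with 2 ≤ n i, LocalZeta.rootFactor q m (n i) s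
      = (LocalZeta.denomFactor q 1 1 * ∏ i ∈ T with 2 ≤ n i,
          LocalZeta.denomFactor q (n i / (n i).gcd m + m / (n i).gcd m)
            (n i / (n i).gcd m * (m / (n i).gcd m) * (n i).gcd m)).eval ((q : ℂ) ^ (-s)) := by
    intro s
    rw [eval_mul, eval_prod, ← LocalZeta.one_sub_cpow_eq_eval_denomFactor hq]
    congr 1
    · simp
    · exact Finset.prod_congr rfl fun i _ => LocalZeta.rootFactor_eq_eval_denomFactor hq m (n i) s
  have hmpos : 0 < m := by omega
  have hquot : ∀ i, n i / (n i).gcd m ≠ 0 := fun i =>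
    (Nat.div_pos (Nat.gcd_le_left m (hn i)) (Nat.gcd_pos_of_pos_right (n i) hmpos)).ne'
  have hquot' : ∀ i, m / (n i).gcd m ≠ 0 := fun i =>
    (Nat.div_pos (Nat.gcd_le_right (n i) hmpos) (Nat.gcd_pos_of_pos_right (n i) hmpos)).ne'
  have hqs : ∀ s : ℂ, AnalyticAt ℂ (fun s : ℂ => (q : ℂ) ^ (-s)) s := by
    intro s
    have : Differentiable ℂ fun s : ℂ => (q : ℂ) ^ (-s) :=
      differentiable_neg.const_cpow (.inl hq0)
    exact this.analyticAt s
  have heval : ∀ (P : ℂ[X]) (s : ℂ), AnalyticAt ℂ (fun s : ℂ => P.eval ((q : ℂ) ^ (-s))) s :=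
    fun P s => (P.differentiable.analyticAt _).comp (hqs s)
  refine ⟨G, ?_⟩
  intro R
  have hR : R = fun s => G.eval ((q : ℂ) ^ (-s)) /
      (LocalZeta.denomFactor q 1 1 * ∏ i ∈ T with 2 ≤ n i,
          LocalZeta.denomFactor q (n i / (n i).gcd m + m / (n i).gcd m)
            (n i / (n i).gcd m * (m / (n i).gcd m) * (n i).gcd m)).eval ((q : ℂ) ^ (-s)) := by
    ext s
    simp only [R, hden]
  refine ⟨fun s hs => ?_, fun s => ?_, fun s hs => ?_⟩
  · have hinteg' := hinteg (LocalZeta.negCpow hq hs)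
    have hz := LocalZeta.zetaIntegrand_eq_quasiChar hϖ χ g hs
    refine ⟨by rw [hz]; exact hinteg', ?_⟩
    -- After Fubini the inner integral is `fiberZeta` at `f x` by definition, so `hG` applies at `t
    -- = q ^ (-s)`.
    rw [LocalZeta.igusaZeta, hz, LocalZeta.integerSquare, setIntegral_prod _ hinteg', hR,
      eq_div_iff, mul_comm]
    · exact hG (LocalZeta.negCpow hq hs)
    · rw [eval_mul, eval_prod]
      refine mul_ne_zero
        (LocalZeta.eval_denomFactor_ne_zero hq one_ne_zero 1 (LocalZeta.negCpow hq hs))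
        (Finset.prod_ne_zero_iff.2 fun i _ => ?_)
      exact LocalZeta.eval_denomFactor_ne_zero hq (fun h => hquot i (Nat.add_eq_zero_iff.1 h).1) _
        (LocalZeta.negCpow hq hs)
  · rw [hR]
    exact (heval _ s).meromorphicAt.div (heval _ s).meromorphicAt
  -- Where the denominator is nonzero `R` is analytic, so a pole forces one of its factors to
  -- vanish; the exponent of `q` is then a multiple of `2 π i / log q`.
  · by_cases hzero : (1 - (q : ℂ) ^ (-1 - s)) *
        ∏ i ∈ T with 2 ≤ n i, LocalZeta.rootFactor q m (n i) s = 0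
    · rcases mul_eq_zero.1 hzero with h | h
      · left
        obtain ⟨l, hl⟩ := LocalZeta.cpow_eq_one_iff hq (sub_eq_zero.1 h).symm
        -- The exponent contains `-s`, hence the change of sign.
        refine ⟨-l, ?_⟩
        rw [Int.cast_neg]
        linear_combination -hl
      · right
        obtain ⟨i, hi, h⟩ := Finset.prod_eq_zero_iff.1 h
        obtain ⟨hiT, hi2⟩ := Finset.mem_filter.1 hi
        refine ⟨i, hiT, hi2, ?_⟩
        obtain ⟨l, hl⟩ := LocalZeta.cpow_eq_one_iff hq (sub_eq_zero.1 h).symm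
        refine ⟨-l, ?_⟩
        rw [eq_div_iff]
        · rw [Int.cast_neg]
          linear_combination -hl
        · have h1 := hquot i
          have h2 := hquot' i
          have h3 : (n i).gcd m ≠ 0 := (Nat.gcd_pos_of_pos_right (n i) hmpos).ne'
          exact_mod_cast mul_ne_zero (mul_ne_zero h1 h2) h3
    · rw [hden] at hzero
      have := ((heval G s).div (heval _ s) hzero).meromorphicOrderAt_nonneg
      rw [hR] at hs
      exact absurd hs this.not_gt
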